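/- All matroids are finite and, unless stated otherwise, simple; a contraction of a matroid is always followed by simplification. Let $P_r=PG(r-1,2)$ denote the rank-$r$ projective geometry over $GF(2)$, where $r\ge 0$ and $P_0$ is the empty matroid. Let $M_1$ and $M_2$ be matroids whose ground sets meet in a set $T$ such that $T$ is a modular flat of $M_1$ and $M_1|T=M_2|T=N$. The generalized parallel connection of $M_1$ and $M_2$ across $N$ is the matroid on $E(M_1)\cup E(M_2)$ whose flats are those subsets $X$ for which $X\cap E(M_1)$ is a flat of $M_1$ and $X\cap E(M_2)$ is a flat of $M_2$. Let $\mathcal{M}_2$, the class of $GF(2)$-chordal matroids, be the class of matroids that can be built from matroids isomorphic to projective geometries over $GF(2)$ by a sequence of generalized parallel connections across projective geometries over $GF(2)$. An induced minor of a matroid $M$ is a matroid obtained from $M$ by a sequence of restrictions to flats and contractions, each contraction being followed by simplification; it is proper if it is not $M$ itself. A forbidden induced minor for $\mathcal{M}_2$ is a simple $GF(2)$-representable matroid that is not in $\mathcal{M}_2$ but all of whose proper induced minors are in $\mathcal{M}_2$. Theorem. Up to isomorphism, the forbidden induced minors for the class $\mathcal{M}_2$ are exactly $M(K_4)$, the cycle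 matroid of the complete graph on four vertices, and the uniform matroid $U_{3,4}$. -/

import Mathlib

open scoped LinearAlgebra.Projectivization

namespace Matroid

/-- `M` is simple: it has no loops (`e = f`) and no two distinct parallel elements. -/
def IsSimpleMatroid {α : Type*} (M : Matroid α) : Prop :=
  ∀ ⦃e f : α⦄, e ∈ M.E → f ∈ M.E → M.Indep {e, f}

/-- `M` is representable over the field `F` by vectors of a finite-dimensional space
(for finite matroids, this is the usual notion of an `F`-representable matroid). -/
def IsRepresentableOver {α : Type*} (F : Type*) [Field F] (M : Matroid α) : Prop :=
  ∃ (n : ℕ) (v : α → (Fin n → F)), ∀ I ⊆ M.E, (M.Indep I ↔ LinearIndepOn F v I)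

/-- `M` is isomorphic to the projective geometry `PG(r-1, F)`, the matroid on the points of
`ℙ(F ^ r)` whose independent sets are the linearly independent sets of points.
For `r = 0` this is the empty matroid. -/
def IsProjectiveGeometryOfRank {α : Type*} (F : Type*) [Field F] (r : ℕ) (M : Matroid α) : Prop :=
  ∃ e : M.E ≃ ℙ F (Fin r → F), ∀ I : Set M.E,
    M.Indep (Subtype.val '' I) ↔ Projectivization.Independent (fun x : I => e x)

/-- `M` is isomorphic to a projective geometry over `F` of some finite rank. -/
def IsProjectiveGeometry {α : Type*} (F : Type*) [Field F] (M : Matroid α) : Prop :=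
  ∃ r : ℕ, M.IsProjectiveGeometryOfRank F r

/-- `T` is a modular flat of `M`. -/
def IsModularFlat {α : Type*} (M : Matroid α) (T : Set α) : Prop :=
  M.IsFlat T ∧ ∀ G, M.IsFlat G → M.eRk T + M.eRk G = M.eRk (T ∪ G) + M.eRk (T ∩ G)

/-- `M` is the generalized parallel connection of `M₁` and `M₂` across the common restriction
`N` of `M₁` and `M₂` to `M₁.E ∩ M₂.E`. -/
structure IsGeneralizedParallelConnection {α : Type*} (M M₁ M₂ N : Matroid α) : Prop where
  isModularFlat : M₁.IsModularFlat (M₁.E ∩ M₂.E)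
  restrict_left : M₁ ↾ (M₁.E ∩ M₂.E) = N
  restrict_right : M₂ ↾ (M₁.E ∩ M₂.E) = N
  ground_eq : M.E = M₁.E ∪ M₂.E
  isFlat_iff : ∀ X ⊆ M₁.E ∪ M₂.E,
    (M.IsFlat X ↔ M₁.IsFlat (X ∩ M₁.E) ∧ M₂.IsFlat (X ∩ M₂.E))

/-- `M` is `F`-chordal: it can be built from projective geometries over `F` by a sequence of
generalized parallel connections across projective geometries over `F`. -/
inductive IsFieldChordal {α : Type*} (F : Type*) [Field F] : Matroid α → Prop
  | projectiveGeometry (M : Matroid α) (h : M.IsProjectiveGeometry F) : IsFieldChordal F M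
  | generalizedParallelConnection (M M₁ M₂ N : Matroid α)
      (h₁ : IsFieldChordal F M₁) (h₂ : IsFieldChordal F M₂) (hN : N.IsProjectiveGeometry F)
      (h : M.IsGeneralizedParallelConnection M₁ M₂ N) : IsFieldChordal F M

/-- `N` is a simplification of `M`: the restriction of `M` to a set `X` consisting of exactly one
element from each parallel class of nonloops. -/
def IsSimplificationOf {α : Type*} (N M : Matroid α) : Prop :=
  ∃ X : Set α, (∀ e ∈ X, M.IsNonloop e) ∧
    (∀ e, M.IsNonloop e → ∃! f, f ∈ X ∧ M.closure {f} = M.closure {e}) ∧ N = M ↾ X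

/-- `M.HasInducedMinor N`: the matroid `N` is obtained from `M` by a sequence of restrictions to
flats and contractions, each contraction being followed by a simplification. -/
inductive HasInducedMinor {α : Type*} (M : Matroid α) : Matroid α → Prop
  | refl : HasInducedMinor M M
  | restrict_flat (N : Matroid α) (F : Set α) (h : HasInducedMinor M N) (hF : N.IsFlat F) :
      HasInducedMinor M (N ↾ F)
  | contract (N N' : Matroid α) (C : Set α) (h : HasInducedMinor M N) (hC : C ⊆ N.E)
      (hN' : N'.IsSimplificationOf (N ／ C)) : HasInducedMinor M N'

/-- `M` is a forbidden induced minor for the class of `F`-chordal matroids: it is a finite simple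
`F`-representable matroid that is not `F`-chordal, while all of its proper induced minors
are `F`-chordal. -/
structure IsForbiddenInducedMinor {α : Type*} (F : Type*) [Field F] (M : Matroid α) : Prop where
  finite : M.Finite
  simple : M.IsSimpleMatroid
  representable : M.IsRepresentableOver F
  not_chordal : ¬ M.IsFieldChordal F
  chordal_of_proper : ∀ N : Matroid α, M.HasInducedMinor N → N ≠ M → N.IsFieldChordal F

/-- `M` is isomorphic to the uniform matroid `U_{k,n}` (for `k ≤ n`). -/
def IsUniformMatroid {α : Type*} (k n : ℕ) (M : Matroid α) : Prop :=
  M.E.encard = n ∧ ∀ I ⊆ M.E, (M.Indep I ↔ I.encard ≤ k)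

/-- `M` is isomorphic to the cycle matroid of the graph `G`: the ground set corresponds to the
edge set of `G`, and the independent sets to the sets of edges that form a forest. -/
def IsCycleMatroidOf {α V : Type*} (G : SimpleGraph V) (M : Matroid α) : Prop :=
  ∃ e : M.E ≃ G.edgeSet, ∀ I : Set M.E,
    M.Indep (Subtype.val '' I) ↔
      (SimpleGraph.fromEdgeSet ((fun x : M.E => (e x : Sym2 V)) '' I)).IsAcyclic

end Matroid

/-! ### Chordal sets of binary vectors, linked parts and round sets. -/

namespace BinaryChordal

open Submodule

variable {V : Type*} [AddCommGroup V] [Module (ZMod 2) V]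

/-! A simple binary matroid is a set `E` of nonzero vectors over GF(2), and chordality becomes
`VChordal`: `E` is glued from full subspaces along full subspaces. Three facts about chordal sets
carry the proof; the first two imitate chordal graphs. Minimal separators are cliques: if `P` and
`Q` are both `Linked` over `P ⊓ Q`, and `E` has no element of `P ⊔ Q` outside them, then every
nonzero vector of `P ⊓ Q` is in `E` (`VChordal.mem_of_linked`). An element of a separator lies on a
triangle whose other two points belong to a linked part behind it (`VChordal.exists_add_mem`). A
round set, one not properly covered by two subspaces, is full if chordal (`VChordal.mem_of_round`).

Let `E` be minimally nonchordal. It suffices to find a subspace meeting `E` in a four-circuit, which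
is U_{3,4}, or in a Fano plane minus a point, which is M(K_4). Neither is chordal, while proper
flats of `E` are, so the section is all of `E`.

If `E` is round, each contraction of an element is round and chordal, hence full. Then the vectors
of the span outside `E` form a subspace, and a bad plane can be read off.

Otherwise take a separation (P, Q) of `E` whose meet Z has least dimension, with P least among
these. Some nonzero vector of Z is missing from `E`, or `E` would be a gluing along Z. There is an
element a of `E` off Q with a + p in `E` for some missing p, such that after contracting a the
members in Z span it. This comes from the first fact applied to the contraction or, when the
elements off Q form part of one coset of Z, from a direct argument. Contracting a turns p into a
member, and the second fact on the Q side yields u with u and u + p in `E`. Then a, a + p, u, u + p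
is a four-circuit, and the other points of its plane are not in `E`.

Conversely, both matroids have rank three, their proper induced minors have rank at most two, and
there every set of nonzero vectors is chordal. -/

/-- Vector version of chordality: sets of nonzero binary vectors built from the nonzero parts of
subspaces by gluing along the nonzero part of a common subspace. -/
inductive VChordal {V : Type*} [AddCommGroup V] [Module (ZMod 2) V] : Set V → Prop
  | pg (U : Submodule (ZMod 2) V) : VChordal {x | x ∈ U ∧ x ≠ 0}
  | glue (E₁ E₂ : Set V) (h₁ : VChordal E₁) (h₂ : VChordal E₂)
      (h : ∀ x ∈ span (ZMod 2) E₁, x ∈ span (ZMod 2) E₂ → x ≠ 0 → x ∈ E₁ ∧ x ∈ E₂) :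
      VChordal (E₁ ∪ E₂)

/-- The elements of `E` in `P` cannot be distributed over two subspaces of `P` that meet in `Z`. -/
def Unsep (E : Set V) (P Z : Submodule (ZMod 2) V) : Prop :=
  ∀ U₁ U₂ : Submodule (ZMod 2) V, Z ≤ U₁ → Z ≤ U₂ → U₁ ≤ P → U₂ ≤ P → U₁ ⊓ U₂ ≤ Z →
    (∀ x ∈ E, x ∈ P → x ∈ U₁ ∨ x ∈ U₂) → P ≤ U₁ ∨ P ≤ U₂

/-- The elements of `E` in `P` off `Z` span `P` and cannot be separated over `Z`. -/
def Linked (E : Set V) (P Z : Submodule (ZMod 2) V) : Prop :=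
  P ≤ span (ZMod 2) {x | x ∈ E ∧ x ∈ P ∧ x ∉ Z} ∧ Unsep E P Z

lemma VChordal.ne_zero {E : Set V} (h : VChordal E) : ∀ x ∈ E, x ≠ 0 := by
  induction h with
  | pg U => exact fun x hx => hx.2
  | glue E₁ E₂ _ _ _ h₁ h₂ => exact fun x hx => hx.elim (h₁ x) (h₂ x)

/-- Over any field a subspace is not the union of two proper subspaces. Applied to the common
subspace of a gluing: its nonzero vectors are all elements, so a cover of the elements by two
subspaces swallows it on one side. -/
lemma le_or_le_of_forall_mem {Y P Q : Submodule (ZMod 2) V} (h : ∀ y ∈ Y, y ∈ P ∨ y ∈ Q) :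
    Y ≤ P ∨ Y ≤ Q := by
  by_contra! hc
  obtain ⟨⟨x, hxY, hxP⟩, y, hyY, hyQ⟩ := hc.imp SetLike.not_le_iff_exists.1 SetLike.not_le_iff_exists.1
  have hx := (h x hxY).resolve_left hxP
  have hy := (h y hyY).resolve_right hyQ
  rcases h _ (Y.add_mem hxY hyY) with h | h
  · exact hxP ((P.add_mem_iff_left hy).1 h)
  · exact hyQ ((Q.add_mem_iff_right hx).1 h)

lemma le_span_sdiff {Y P : Submodule (ZMod 2) V} (h : ¬ Y ≤ P) :
    Y ≤ span (ZMod 2) {y | y ∈ Y ∧ y ∉ P} := by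
  obtain ⟨y, hy, hyP⟩ := SetLike.not_le_iff_exists.1 h
  intro x hx
  by_cases hxP : x ∈ P
  · rw [← add_sub_cancel_right x y]
    refine sub_mem (subset_span ⟨Y.add_mem hx hy, fun h => hyP ?_⟩) (subset_span ⟨hy, hyP⟩)
    exact (P.add_mem_iff_right hxP).1 h
  · exact subset_span ⟨hx, hxP⟩

lemma exists_add_of_mem_span {S A B : Set V} {x : V} (hS : S ⊆ A ∪ B)
    (hx : x ∈ span (ZMod 2) S) : ∃ a ∈ span (ZMod 2) A, ∃ b ∈ span (ZMod 2) B, a + b = x := by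
  rw [← mem_sup, ← span_union]
  exact span_mono hS hx

lemma exists_split {E E₁ E₂ : Set V} {P : Submodule (ZMod 2) V} (hE : E ⊆ E₁ ∪ E₂)
    (h : P ≤ span (ZMod 2) {x | x ∈ E ∧ x ∈ P}) {x : V} (hx : x ∈ P) :
    ∃ a ∈ P, a ∈ span (ZMod 2) E₁ ∧ ∃ b ∈ P, b ∈ span (ZMod 2) E₂ ∧ a + b = x := by
  obtain ⟨a, ha, b, hb, hab⟩ := exists_add_of_mem_span
    (A := {x | x ∈ E₁ ∧ x ∈ P}) (B := {x | x ∈ E₂ ∧ x ∈ P})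
    (fun y hy => (hE hy.1).imp (⟨·, hy.2⟩) (⟨·, hy.2⟩)) (h hx)
  exact ⟨a, span_le.2 (fun y hy => hy.2) ha, span_mono (fun y hy => hy.1) ha,
    b, span_le.2 (fun y hy => hy.2) hb, span_mono (fun y hy => hy.1) hb, hab⟩

lemma Linked.le_span {E : Set V} {P Z : Submodule (ZMod 2) V} (h : Linked E P Z) :
    P ≤ span (ZMod 2) {x | x ∈ E ∧ x ∈ P} :=
  h.1.trans (span_mono fun _ hx => ⟨hx.1, hx.2.1⟩)

/-- `Q ⊓ X₁` and `Q ⊓ X₂`, enlarged by `Z`, form a separation of `Q` over `Z`, so one of them is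
`Q`. An element of `Q` on the wrong side would lie in both enlarged parts, hence in `Z`; the
elements off `Z` span `Q`, so `Q` lies in that `X`. -/
lemma Linked.le_or_le {E : Set V} {X₁ X₂ Q Z : Submodule (ZMod 2) V} (h : Linked E Q Z)
    (hZQ : Z ≤ Q) (hE : ∀ x ∈ E, x ∈ X₁ ∨ x ∈ X₂)
    (hZ : ∀ z ∈ Z, ∃ a ∈ Z, a ∈ X₁ ∧ ∃ b ∈ Z, b ∈ X₂ ∧ a + b = z)
    (hY : ∀ y ∈ X₁, y ∈ X₂ → y ∈ Q → y ∈ Z) : Q ≤ X₁ ∨ Q ≤ X₂ := by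
  have key : (Q ⊓ X₁ ⊔ Z) ⊓ (Q ⊓ X₂ ⊔ Z) ≤ Z := by
    rintro x ⟨hx₁, hx₂⟩
    obtain ⟨u, ⟨huQ, hu⟩, z, hz, rfl⟩ := mem_sup.1 hx₁
    obtain ⟨v, ⟨hvQ, hv⟩, w, hw, hvw⟩ := mem_sup.1 hx₂
    -- The discrepancy in `Z` is divided between the two sides, which produces the vector `u + a = v
    -- - b` common to `X₁`, `X₂` and `Q`.
    obtain ⟨a, haZ, ha, b, hbZ, hb, hab⟩ := hZ (z - w) (sub_mem hz hw)
    have h1 : u + a = v - b := by grind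
    have h2 : u + a ∈ Z := hY _ (add_mem hu ha) (h1 ▸ sub_mem hv hb)
      (add_mem huQ (hZQ haZ))
    exact add_mem ((Z.add_mem_iff_left haZ).1 h2) hz
  have main : ∀ U W : Submodule (ZMod 2) V, (Q ⊓ U ⊔ Z) ⊓ (Q ⊓ W ⊔ Z) ≤ Z →
      (∀ x ∈ E, x ∈ U ∨ x ∈ W) → Q ≤ Q ⊓ U ⊔ Z → Q ≤ U := by
    intro U W hUW hE hQ
    refine h.1.trans (span_le.2 fun x hx => (hE x hx.1).resolve_right fun hW => hx.2.2 ?_)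
    exact hUW ⟨hQ hx.2.1, mem_sup_left ⟨hx.2.1, hW⟩⟩
  refine (h.2 (Q ⊓ X₁ ⊔ Z) (Q ⊓ X₂ ⊔ Z) le_sup_right le_sup_right (sup_le inf_le_left hZQ)
    (sup_le inf_le_left hZQ) key fun x hx hxQ => (hE x hx).imp (fun hx => mem_sup_left ⟨hxQ, hx⟩)
    (fun hx => mem_sup_left ⟨hxQ, hx⟩)).imp (main _ _ key hE) ?_
  exact main _ _ (inf_comm (a := Q ⊓ X₁ ⊔ Z) _ ▸ key) fun x hx => (hE x hx).symm

/-- Linkedness passes to one piece of a gluing when the common subspace reaches into `P` off `Z`.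
Its nonzero vectors are elements of `E₁`, so they replace the contribution of `E₂` to the spanning
condition, and any separation of the `E₁` part keeps them on one side, where the `E₂` part can be
attached to separate `P`. -/
lemma Linked.inf_span {E₁ E₂ : Set V} {P Z : Submodule (ZMod 2) V} (h : Linked (E₁ ∪ E₂) P Z)
    (hZP : Z ≤ P) (hE : ∀ x ∈ span (ZMod 2) E₁, x ∈ span (ZMod 2) E₂ → x ≠ 0 → x ∈ E₁ ∧ x ∈ E₂)
    (hZ : ∀ z ∈ Z, ∃ a ∈ Z, a ∈ span (ZMod 2) E₁ ∧ ∃ b ∈ Z, b ∈ span (ZMod 2) E₂ ∧ a + b = z)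
    (hY : ¬ span (ZMod 2) E₁ ⊓ span (ZMod 2) E₂ ⊓ P ≤ Z) :
    Linked E₁ (P ⊓ span (ZMod 2) E₁) (Z ⊓ span (ZMod 2) E₁) := by
  set X₁ := span (ZMod 2) E₁ with hX₁
  set X₂ := span (ZMod 2) E₂ with hX₂
  have hYE : ∀ y ∈ X₁ ⊓ X₂ ⊓ P, y ∉ Z → y ∈ E₁ := fun y hy hyZ =>
    (hE y hy.1.1 hy.1.2 fun h0 => hyZ (h0 ▸ zero_mem _)).1
  constructor
  · rintro x ⟨hxP, hxX⟩
    obtain ⟨a, ha, b, hb, rfl⟩ := exists_add_of_mem_span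
      (A := {x | x ∈ E₁ ∧ x ∈ P ∧ x ∉ Z}) (B := {x | x ∈ E₂ ∧ x ∈ P ∧ x ∉ Z})
      (fun y hy => hy.1.imp (⟨·, hy.2⟩) (⟨·, hy.2⟩)) (h.1 hxP)
    have haX : a ∈ X₁ := span_mono (fun y hy => hy.1) ha
    have hbX : b ∈ X₂ := span_mono (fun y hy => hy.1) hb
    have hbP : b ∈ P := span_le.2 (fun y hy => hy.2.1) hb
    have hbY : b ∈ X₁ ⊓ X₂ ⊓ P := ⟨⟨(X₁.add_mem_iff_right haX).1 hxX, hbX⟩, hbP⟩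
    refine add_mem (span_mono ?_ ha) (span_mono ?_ (le_span_sdiff hY hbY))
    · exact fun y hy => ⟨hy.1, ⟨hy.2.1, subset_span hy.1⟩, fun h => hy.2.2 h.1⟩
    · exact fun y hy => ⟨hYE y hy.1 hy.2, ⟨hy.1.2, hy.1.1.1⟩, fun h => hy.2 h.1⟩
  -- `U` is the side that contains the common subspace; the separation of `P` is formed by `U ⊔ X₂ ⊓
  -- P` and `W ⊔ Z`.
  · have main : ∀ U W : Submodule (ZMod 2) V, Z ⊓ X₁ ≤ U → Z ⊓ X₁ ≤ W → U ≤ P ⊓ X₁ →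
        W ≤ P ⊓ X₁ → U ⊓ W ≤ Z ⊓ X₁ → (∀ x ∈ E₁, x ∈ P ⊓ X₁ → x ∈ U ∨ x ∈ W) →
        X₁ ⊓ X₂ ⊓ P ≤ U → P ⊓ X₁ ≤ U ∨ P ⊓ X₁ ≤ W := by
      intro U W hZU hZW hUP hWP hUW hc hYU
      refine (h.2 (U ⊔ X₂ ⊓ P) (W ⊔ Z) ?_ le_sup_right (sup_le (hUP.trans inf_le_left) inf_le_right)
        (sup_le (hWP.trans inf_le_left) hZP) ?_ ?_).imp ?_ ?_
      · intro z hz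
        obtain ⟨a, haZ, ha, b, hbZ, hb, rfl⟩ := hZ z hz
        exact add_mem (mem_sup_left (hZU ⟨haZ, ha⟩)) (mem_sup_right ⟨hb, hZP hbZ⟩)
      · rintro x ⟨hx₁, hx₂⟩
        obtain ⟨u, hu, v, hv, rfl⟩ := mem_sup.1 hx₁
        obtain ⟨w, hw, z, hz, hwz⟩ := mem_sup.1 hx₂
        obtain ⟨a, haZ, ha, b, hbZ, hb, rfl⟩ := hZ z hz
        have h1 : v - b = w + a - u := by grind
        have hwa : w + a ∈ W := add_mem hw (hZW ⟨haZ, ha⟩)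
        have h2 : v - b ∈ U := hYU ⟨⟨h1 ▸ sub_mem (hWP hwa).2 (hUP hu).2, sub_mem hv.1 hb⟩,
          sub_mem hv.2 (hZP hbZ)⟩
        have h3 : w + a ∈ U := by
          have : w + a = (v - b) + u := by grind
          exact this ▸ add_mem h2 hu
        rw [← hwz, ← add_assoc]
        exact add_mem (hUW ⟨h3, hwa⟩).1 hbZ
      · rintro x (hx | hx) hxP
        · exact (hc x hx ⟨hxP, subset_span hx⟩).imp mem_sup_left mem_sup_left
        · exact Or.inl (mem_sup_right ⟨subset_span hx, hxP⟩)
      · rintro hP x ⟨hxP, hxX⟩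
        obtain ⟨u, hu, v, hv, rfl⟩ := mem_sup.1 (hP hxP)
        exact add_mem hu (hYU ⟨⟨(X₁.add_mem_iff_right (hUP hu).2).1 hxX, hv.1⟩, hv.2⟩)
      · rintro hP x ⟨hxP, hxX⟩
        obtain ⟨u, hu, v, hv, rfl⟩ := mem_sup.1 (hP hxP)
        exact add_mem hu (hZW ⟨hv, (X₁.add_mem_iff_right (hWP hu).2).1 hxX⟩)
    intro U W hZU hZW hUP hWP hUW hc
    have hY' : ∀ y ∈ X₁ ⊓ X₂ ⊓ P, y ∈ U ∨ y ∈ W := by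
      intro y hy
      by_cases hyZ : y ∈ Z
      · exact Or.inl (hZU ⟨hyZ, hy.1.1⟩)
      · exact hc y (hYE y hy hyZ) ⟨hy.2, hy.1.1⟩
    rcases le_or_le_of_forall_mem hY' with hY' | hY'
    · exact main U W hZU hZW hUP hWP hUW hc hY'
    · exact (main W U hZW hZU hWP hUP (inf_comm U W ▸ hUW) (fun x hx hxP => (hc x hx hxP).symm)
        hY').symm

/-- In a chordal set, a subspace that separates two linked parts is full. -/
theorem VChordal.mem_of_linked {E : Set V} (hE : VChordal E) :
    ∀ {P Q : Submodule (ZMod 2) V}, Linked E P (P ⊓ Q) → Linked E Q (P ⊓ Q) →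
      (∀ x ∈ E, x ∈ P ⊔ Q → x ∈ P ∨ x ∈ Q) → ∀ z ∈ P ⊓ Q, z ≠ 0 → z ∈ E := by
  induction hE with
  | pg U =>
    intro P Q hP _ _ z hz hz0
    refine ⟨(hP.1.trans (span_le.2 fun x hx => ?_)) hz.1, hz0⟩
    exact hx.1.1
  | glue E₁ E₂ hE₁ hE₂ hg IH₁ IH₂ =>
    -- The case where `Q` lies on the first side. It is stated for arbitrary `E₁`, `E₂` so that it
    -- also serves with the pieces exchanged.
    have first : ∀ E₁ E₂ : Set V, (∀ x ∈ E₁ ∪ E₂, x ≠ 0) → (∀ {P Q : Submodule (ZMod 2) V}, Linked E₁ P (P ⊓ Q) →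
        Linked E₁ Q (P ⊓ Q) → (∀ x ∈ E₁, x ∈ P ⊔ Q → x ∈ P ∨ x ∈ Q) →
          ∀ z ∈ P ⊓ Q, z ≠ 0 → z ∈ E₁) →
        (∀ x ∈ span (ZMod 2) E₁, x ∈ span (ZMod 2) E₂ → x ≠ 0 → x ∈ E₁ ∧ x ∈ E₂) →
        ∀ {P Q : Submodule (ZMod 2) V}, Linked (E₁ ∪ E₂) P (P ⊓ Q) →
        Linked (E₁ ∪ E₂) Q (P ⊓ Q) → (∀ x ∈ E₁ ∪ E₂, x ∈ P ⊔ Q → x ∈ P ∨ x ∈ Q) →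
        (∀ z ∈ P ⊓ Q, ∃ a ∈ P ⊓ Q, a ∈ span (ZMod 2) E₁ ∧ ∃ b ∈ P ⊓ Q,
          b ∈ span (ZMod 2) E₂ ∧ a + b = z) →
        Q ≤ span (ZMod 2) E₁ → ∀ z ∈ P ⊓ Q, z ≠ 0 → z ∈ E₁ := by
      intro E₁ E₂ h0 IH hg P Q hP hQ hs hZ hQX z hz hz0
      have hZX : P ⊓ Q ⊓ span (ZMod 2) E₁ = P ⊓ Q := inf_eq_left.2 (inf_le_right.trans hQX)
      have hmem : ∀ x ∈ E₁ ∪ E₂, x ∈ span (ZMod 2) E₁ → x ∈ E₁ := by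
        rintro x (hx | hx) hx'
        · exact hx
        · exact (hg x hx' (subset_span hx) (h0 x (Or.inr hx))).1
      have restr : ∀ R : Submodule (ZMod 2) V, R ≤ span (ZMod 2) E₁ →
          Linked (E₁ ∪ E₂) R (P ⊓ Q) → Linked E₁ R (P ⊓ Q) := by
        intro R hR hL
        refine ⟨hL.1.trans (span_mono fun x hx => ⟨hmem x hx.1 (hR hx.2.1), hx.2⟩), ?_⟩
        intro U W h1 h2 h3 h4 h5 h6
        exact hL.2 U W h1 h2 h3 h4 h5 fun x hx hxR => h6 x (hmem x hx (hR hxR)) hxR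
      -- If the common subspace meets `P` only inside `P ⊓ Q`, then `P` lies on one side: on the
      -- first, induction applies; on the second, `z` is in both spans. Otherwise `P ⊓ span E₁` is
      -- still linked over the same meet and replaces `P`.
      by_cases hYP : span (ZMod 2) E₁ ⊓ span (ZMod 2) E₂ ⊓ P ≤ P ⊓ Q
      · rcases hP.le_or_le inf_le_left
          (fun x hx => hx.imp (fun h => subset_span h) (fun h => subset_span h)) hZ
          (fun y h1 h2 h3 => hYP ⟨⟨h1, h2⟩, h3⟩) with hPX | hPX
        · exact IH (restr P hPX hP) (restr Q hQX hQ) (fun x hx => hs x (Or.inl hx)) z hz hz0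
        · exact (hg z (hQX hz.2) (hPX hz.1) hz0).1
      · have hL := hP.inf_span inf_le_left hg hZ hYP
        have hZ' : P ⊓ span (ZMod 2) E₁ ⊓ Q = P ⊓ Q := by rw [inf_right_comm, hZX]
        rw [hZX] at hL
        refine IH (P := P ⊓ span (ZMod 2) E₁) (Q := Q) (by rwa [hZ']) (by rw [hZ']; exact restr Q hQX hQ) ?_ z
          (hZ' ▸ hz) hz0
        intro x hx hxs
        exact (hs x (Or.inl hx) ((sup_le_sup inf_le_left le_rfl :
          P ⊓ span (ZMod 2) E₁ ⊔ Q ≤ P ⊔ Q) hxs)).imp_left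
          (⟨·, subset_span hx⟩)
    -- The common subspace meets `P ⊔ Q` inside `P`. Comparing a splitting of `z` within `P` with
    -- one within `Q`, the two differ by a vector of the common subspace, so the splitting within
    -- `Q` is in fact within `P ⊓ Q`.
    have second : ∀ {P Q : Submodule (ZMod 2) V}, Linked (E₁ ∪ E₂) P (P ⊓ Q) →
        Linked (E₁ ∪ E₂) Q (P ⊓ Q) → (∀ x ∈ E₁ ∪ E₂, x ∈ P ⊔ Q → x ∈ P ∨ x ∈ Q) →
        span (ZMod 2) E₁ ⊓ span (ZMod 2) E₂ ⊓ (P ⊔ Q) ≤ P →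
        ∀ z ∈ P ⊓ Q, z ≠ 0 → z ∈ E₁ ∪ E₂ := by
      intro P Q hP hQ hs hY z hz hz0
      have hZ : ∀ z ∈ P ⊓ Q, ∃ a ∈ P ⊓ Q, a ∈ span (ZMod 2) E₁ ∧ ∃ b ∈ P ⊓ Q,
          b ∈ span (ZMod 2) E₂ ∧ a + b = z := by
        intro z hz
        obtain ⟨a, haP, ha, b, hbP, hb, rfl⟩ := exists_split subset_rfl hP.le_span hz.1
        obtain ⟨c, hcQ, hc, d, hdQ, hd, hcd⟩ := exists_split subset_rfl hQ.le_span hz.2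
        have h1 : c - a = b - d := by grind
        have h2 : c - a ∈ P := hY ⟨⟨sub_mem hc ha, h1 ▸ sub_mem hb hd⟩,
          sub_mem (mem_sup_right hcQ) (mem_sup_left haP)⟩
        have hcP : c ∈ P := (P.sub_mem_iff_left haP).1 h2
        refine ⟨c, ⟨hcP, hcQ⟩, hc, d, ⟨?_, hdQ⟩, hd, hcd⟩
        exact (P.add_mem_iff_right hcP).1 (hcd ▸ hz.1)
      rcases hQ.le_or_le inf_le_right
          (fun x hx => hx.imp (fun h => subset_span h) (fun h => subset_span h)) hZ
          (fun y h1 h2 h3 => ⟨hY ⟨⟨h1, h2⟩, mem_sup_right h3⟩, h3⟩) with hQX | hQX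
      · exact Or.inl (first E₁ E₂ (VChordal.glue _ _ hE₁ hE₂ hg).ne_zero IH₁ hg hP hQ hs hZ hQX z hz hz0)
      · rw [Set.union_comm] at hP hQ hs
        refine Or.inr (first E₂ E₁ (Set.union_comm E₁ E₂ ▸ (VChordal.glue _ _ hE₁ hE₂ hg).ne_zero) IH₂ (fun x h1 h2 h3 => (hg x h2 h1 h3).symm) hP hQ hs ?_ hQX
          z hz hz0)
        intro z hz
        obtain ⟨a, haZ, ha, b, hbZ, hb, rfl⟩ := hZ z hz
        exact ⟨b, hbZ, hb, a, haZ, ha, add_comm b a⟩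
    intro P Q hP hQ hs z hz hz0
    have hY : ∀ y ∈ span (ZMod 2) E₁ ⊓ span (ZMod 2) E₂ ⊓ (P ⊔ Q), y ∈ P ∨ y ∈ Q := by
      intro y hy
      by_cases h0 : y = 0
      · exact Or.inl (h0 ▸ zero_mem _)
      · exact hs y (Or.inl (hg y hy.1.1 hy.1.2 h0).1) hy.2
    rcases le_or_le_of_forall_mem hY with hY | hY
    · exact second hP hQ hs hY z hz hz0
    · refine second (P := Q) (Q := P) (inf_comm P Q ▸ hQ) (inf_comm P Q ▸ hP)
        (fun x hx hxs => (hs x hx (sup_comm P Q ▸ hxs)).symm) (sup_comm P Q ▸ hY) z ⟨hz.2, hz.1⟩ hz0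

/-- In a chordal set spanned by a linked part off `Z`, where `Z` is spanned by its own elements,
every element of `Z` is the sum of two elements off `Z`. -/
theorem VChordal.exists_add_mem {E : Set V} (hE : VChordal E) :
    ∀ {Z : Submodule (ZMod 2) V}, Z ≤ span (ZMod 2) {x | x ∈ E ∧ x ∈ Z} →
      Linked E (span (ZMod 2) E) Z → ∀ e ∈ E, e ∈ Z → ∃ u ∈ E, u ∉ Z ∧ e + u ∈ E := by
  induction hE with
  | pg U =>
    intro Z hZ hL e he heZ
    by_contra! hc
    have h0 : {x | x ∈ {x | x ∈ U ∧ x ≠ 0} ∧ x ∈ span (ZMod 2) {x | x ∈ U ∧ x ≠ 0} ∧ x ∉ Z}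
        = ∅ := by
      refine Set.eq_empty_of_forall_notMem fun x hx => hc x hx.1 hx.2.2 ⟨?_, fun h => hx.2.2 ?_⟩
      · exact add_mem he.1 hx.1.1
      · exact (Z.add_mem_iff_right heZ).1 (h ▸ zero_mem _)
    have h1 := hL.1
    rw [h0, span_empty] at h1
    exact he.2 (h1 (subset_span he))
  | glue E₁ E₂ hE₁ hE₂ hg IH₁ IH₂ =>
    -- Both hypotheses are inherited by `E₁`: linkedness by `Linked.inf_span`, and spanning of `Z`
    -- because the `E₂` part of a vector of `span E₁` is zero or an element of `E₁`.
    have first : ∀ E₁ E₂ : Set V, (∀ x ∈ E₁ ∪ E₂, x ≠ 0) →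
        (∀ {Z : Submodule (ZMod 2) V}, Z ≤ span (ZMod 2) {x | x ∈ E₁ ∧ x ∈ Z} →
          Linked E₁ (span (ZMod 2) E₁) Z → ∀ e ∈ E₁, e ∈ Z → ∃ u ∈ E₁, u ∉ Z ∧ e + u ∈ E₁) →
        (∀ x ∈ span (ZMod 2) E₁, x ∈ span (ZMod 2) E₂ → x ≠ 0 → x ∈ E₁ ∧ x ∈ E₂) →
        ∀ {Z : Submodule (ZMod 2) V}, Z ≤ span (ZMod 2) {x | x ∈ E₁ ∪ E₂ ∧ x ∈ Z} →
          Linked (E₁ ∪ E₂) (span (ZMod 2) (E₁ ∪ E₂)) Z →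
          (E₂ ⊆ E₁ ∨ ¬ span (ZMod 2) E₁ ⊓ span (ZMod 2) E₂ ≤ Z) →
          ∀ e ∈ E₁, e ∈ Z → ∃ u ∈ E₁, u ∉ Z ∧ e + u ∈ E₁ := by
      intro E₁ E₂ h0 IH hg Z hZ hL hor e he heZ
      rcases hor with hor | hor
      · rw [Set.union_eq_left.2 hor] at hZ hL
        exact IH hZ hL e he heZ
      have hle : span (ZMod 2) E₁ ≤ span (ZMod 2) (E₁ ∪ E₂) := span_mono Set.subset_union_left
      have hZP : Z ≤ span (ZMod 2) (E₁ ∪ E₂) := hZ.trans (span_mono fun x hx => hx.1)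
      have key := hL.inf_span hZP hg (fun z hz => exists_split subset_rfl hZ hz)
        (by rwa [inf_eq_left.2 (inf_le_left.trans hle)])
      rw [inf_eq_right.2 hle] at key
      suffices hsp : Z ⊓ span (ZMod 2) E₁ ≤
          span (ZMod 2) {x | x ∈ E₁ ∧ x ∈ Z ⊓ span (ZMod 2) E₁} by
        obtain ⟨u, hu, huZ, heu⟩ := IH hsp key e he ⟨heZ, subset_span he⟩
        exact ⟨u, hu, fun h => huZ ⟨h, subset_span hu⟩, heu⟩
      rintro z ⟨hz, hzX⟩
      obtain ⟨a, ha, b, hb, rfl⟩ := exists_add_of_mem_span (A := {x | x ∈ E₁ ∧ x ∈ Z})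
        (B := {x | x ∈ E₂ ∧ x ∈ Z}) (fun y hy => hy.1.imp (⟨·, hy.2⟩) (⟨·, hy.2⟩)) (hZ hz)
      have haX : a ∈ span (ZMod 2) E₁ := span_mono (fun y hy => hy.1) ha
      have hbX : b ∈ span (ZMod 2) E₁ := ((span (ZMod 2) E₁).add_mem_iff_right haX).1 hzX
      have hbZ : b ∈ Z := span_le.2 (fun y hy => hy.2) hb
      have hsub : {x | x ∈ E₁ ∧ x ∈ Z} ⊆ {x | x ∈ E₁ ∧ x ∈ Z ⊓ span (ZMod 2) E₁} :=
        fun y hy => ⟨hy.1, hy.2, subset_span hy.1⟩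
      refine add_mem (span_mono hsub ha) ?_
      by_cases hb0 : b = 0
      · exact hb0 ▸ zero_mem _
      · exact subset_span ⟨(hg b hbX (span_mono (fun y hy => hy.1) hb) hb0).1, hbZ, hbX⟩
    intro Z hZ hL e he heZ
    have h0 := (VChordal.glue _ _ hE₁ hE₂ hg).ne_zero
    -- If the common subspace lies in `Z`, linkedness puts everything into one of the two spans, and
    -- then one piece contains the other.
    have hor : E₂ ⊆ E₁ ∨ E₁ ⊆ E₂ ∨ ¬ span (ZMod 2) E₁ ⊓ span (ZMod 2) E₂ ≤ Z := by
      by_cases hY : span (ZMod 2) E₁ ⊓ span (ZMod 2) E₂ ≤ Z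
      · rcases hL.le_or_le (hZ.trans (span_mono fun x hx => hx.1))
          (fun x hx => hx.imp (fun h => subset_span h) (fun h => subset_span h))
          (fun z hz => exists_split subset_rfl hZ hz) (fun y h1 h2 _ => hY ⟨h1, h2⟩) with h | h
        · refine Or.inl fun x hx => (hg x (h (subset_span (Or.inr hx))) (subset_span hx) ?_).1
          exact h0 x (Or.inr hx)
        · refine Or.inr (Or.inl fun x hx =>
            (hg x (subset_span hx) (h (subset_span (Or.inl hx))) ?_).2)
          exact h0 x (Or.inl hx)
      · exact Or.inr (Or.inr hY)
    by_cases he₁ : e ∈ E₁ ∧ (E₂ ⊆ E₁ ∨ ¬ span (ZMod 2) E₁ ⊓ span (ZMod 2) E₂ ≤ Z)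
    · obtain ⟨u, hu, huZ, heu⟩ := first E₁ E₂ h0 IH₁ hg hZ hL he₁.2 e he₁.1 heZ
      exact ⟨u, Or.inl hu, huZ, Or.inl heu⟩
    · have he₂ : e ∈ E₂ ∧ (E₁ ⊆ E₂ ∨ ¬ span (ZMod 2) E₂ ⊓ span (ZMod 2) E₁ ≤ Z) := by
        rw [inf_comm]
        have : e ∈ E₁ ∨ e ∈ E₂ := he
        by_cases h1 : E₂ ⊆ E₁
        · exact absurd ⟨this.elim id (fun h => h1 h), Or.inl h1⟩ he₁
        · rcases hor with h | h | h
          · exact absurd h h1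
          · exact ⟨this.elim (fun h' => h h') id, Or.inl h⟩
          · exact ⟨this.resolve_left fun h' => he₁ ⟨h', Or.inr h⟩, Or.inr h⟩
      rw [Set.union_comm] at hZ hL h0
      obtain ⟨u, hu, huZ, heu⟩ := first E₂ E₁ h0 IH₂ (fun x h1 h2 h3 => (hg x h2 h1 h3).symm) hZ hL
        he₂.2 e he₂.1 heZ
      exact ⟨u, Or.inr hu, huZ, Or.inr heu⟩

/-- A set of vectors is round if it is not covered by two subspaces in a nontrivial way. -/
def Round (E : Set V) : Prop :=
  ∀ P Q : Submodule (ZMod 2) V, (∀ x ∈ E, x ∈ P ∨ x ∈ Q) → (∀ x ∈ E, x ∈ P) ∨ ∀ x ∈ E, x ∈ Q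

/-- The spans of two glued pieces cover the set, so by roundness one span contains everything. The
gluing condition then makes the other piece redundant. -/
theorem VChordal.mem_of_round {E : Set V} (hE : VChordal E) (hr : Round E) :
    ∀ x ∈ span (ZMod 2) E, x ≠ 0 → x ∈ E := by
  induction hE with
  | pg U => exact fun x hx hx0 => ⟨span_le.2 (fun y hy => hy.1) hx, hx0⟩
  | glue E₁ E₂ hE₁ hE₂ hg IH₁ IH₂ =>
    have h0 := (VChordal.glue _ _ hE₁ hE₂ hg).ne_zero
    rcases hr (span (ZMod 2) E₁) (span (ZMod 2) E₂)
      (fun x hx => hx.imp (fun h => subset_span h) (fun h => subset_span h)) with h | h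
    · have : E₁ ∪ E₂ = E₁ := Set.union_eq_left.2 fun x hx =>
        (hg x (h x (Or.inr hx)) (subset_span hx) (h0 x (Or.inr hx))).1
      rw [this] at hr ⊢
      exact IH₁ hr
    · have : E₁ ∪ E₂ = E₂ := Set.union_eq_right.2 fun x hx =>
        (hg x (subset_span hx) (h x (Or.inl hx)) (h0 x (Or.inl hx))).2
      rw [this] at hr ⊢
      exact IH₂ hr

end BinaryChordal

/-! ### Contraction of one vector, and unseparable parts. -/

namespace BinaryChordal

open Submodule

variable {V : Type*} [AddCommGroup V] [Module (ZMod 2) V]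

/-- The nonzero images, modulo `a`, of the elements of `E` in `U`. -/
def contr (E : Set V) (U : Submodule (ZMod 2) V) (a : V) :
    Set (V ⧸ span (ZMod 2) {a}) :=
  {y | y ≠ 0 ∧ ∃ x ∈ E, x ∈ U ∧ mkQ (span (ZMod 2) {a}) x = y}

lemma mem_span_singleton_iff {a x : V} : x ∈ span (ZMod 2) {a} ↔ x = 0 ∨ x = a := by
  rw [mem_span_singleton]
  constructor
  · rintro ⟨c, rfl⟩
    have : c = 0 ∨ c = 1 := by revert c; decide
    rcases this with rfl | rfl <;> simp
  · rintro (rfl | rfl)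
    · exact ⟨0, by simp⟩
    · exact ⟨1, by simp⟩

lemma mkQ_eq_iff {a x y : V} :
    mkQ (span (ZMod 2) {a}) x = mkQ (span (ZMod 2) {a}) y ↔ x = y ∨ x = y + a := by
  rw [mkQ_apply, mkQ_apply, Submodule.Quotient.eq, mem_span_singleton_iff, sub_eq_zero,
    sub_eq_iff_eq_add']

lemma mem_of_mkQ_mem_map {a x : V} {P : Submodule (ZMod 2) V} (ha : a ∈ P)
    (h : mkQ (span (ZMod 2) {a}) x ∈ P.map (mkQ (span (ZMod 2) {a}))) : x ∈ P := by
  obtain ⟨p, hp, hpx⟩ := h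
  rcases mkQ_eq_iff.1 hpx.symm with rfl | rfl
  · exact hp
  · exact add_mem hp ha

/-- Subspaces of the quotient correspond to subspaces containing `a`, so separations lift. For the
spanning condition it is enough that the elements off `Z` span `P` together with `a`. -/
lemma linked_map {E : Set V} {P Z U : Submodule (ZMod 2) V} {a : V} (ha : a ∈ Z) (hZP : Z ≤ P)
    (hPU : P ≤ U) (hfull : P ≤ span (ZMod 2) {x | x ∈ E ∧ x ∈ P ∧ x ∉ Z} ⊔ span (ZMod 2) {a})
    (hu : Unsep E P Z) : Linked (contr E U a) (P.map (mkQ (span (ZMod 2) {a})))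
      (Z.map (mkQ (span (ZMod 2) {a}))) := by
  constructor
  · refine (map_mono hfull).trans ?_
    rw [Submodule.map_sup, mkQ_map_self, sup_bot_eq, map_span, span_le]
    rintro _ ⟨x, ⟨hx, hxP, hxZ⟩, rfl⟩
    refine subset_span ⟨⟨?_, x, hx, hPU hxP, rfl⟩, mem_map_of_mem hxP,
      fun h => hxZ (mem_of_mkQ_mem_map ha h)⟩
    intro h0
    exact hxZ (mem_of_mkQ_mem_map ha (h0 ▸ zero_mem _))
  · intro U₁ U₂ h1 h2 h3 h4 h5 h6
    have hle : ∀ W : Submodule (ZMod 2) (V ⧸ span (ZMod 2) {a}),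
        W ≤ P.map (mkQ (span (ZMod 2) {a})) → W.comap (mkQ (span (ZMod 2) {a})) ≤ P :=
      fun W hW x hx => mem_of_mkQ_mem_map (hZP ha) (hW hx)
    rw [map_le_iff_le_comap, map_le_iff_le_comap]
    refine hu _ _ (map_le_iff_le_comap.1 h1) (map_le_iff_le_comap.1 h2) (hle _ h3) (hle _ h4)
      (fun x hx => mem_of_mkQ_mem_map ha (h5 hx)) fun x hx hxP => ?_
    by_cases h0 : mkQ (span (ZMod 2) {a}) x = 0
    · exact Or.inl (by rw [mem_comap, h0]; exact zero_mem _)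
    · exact h6 _ ⟨h0, x, hx, hPU hxP, rfl⟩ (mem_map_of_mem hxP)

/-- This is `VChordal.mem_of_linked` in the quotient, read back: the class of `z` consists of `z`
and `z + a` only. -/
lemma mem_or_add_mem_of_linked {E : Set V} {P Q : Submodule (ZMod 2) V} {a : V}
    (hE : VChordal (contr E ⊤ a)) (ha : a ∈ P ⊓ Q)
    (hP : P ≤ span (ZMod 2) {x | x ∈ E ∧ x ∈ P ∧ x ∉ P ⊓ Q} ⊔ span (ZMod 2) {a})
    (hQ : Q ≤ span (ZMod 2) {x | x ∈ E ∧ x ∈ Q ∧ x ∉ P ⊓ Q} ⊔ span (ZMod 2) {a})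
    (hPu : Unsep E P (P ⊓ Q)) (hQu : Unsep E Q (P ⊓ Q))
    (hs : ∀ x ∈ E, x ∈ P ⊔ Q → x ∈ P ∨ x ∈ Q) {z : V} (hz : z ∈ P ⊓ Q) (hz0 : z ≠ 0)
    (hza : z ≠ a) : z ∈ E ∨ z + a ∈ E := by
  have hinf : P.map (mkQ (span (ZMod 2) {a})) ⊓ Q.map (mkQ (span (ZMod 2) {a})) =
      (P ⊓ Q).map (mkQ (span (ZMod 2) {a})) := by
    refine le_antisymm ?_ (le_inf (map_mono inf_le_left) (map_mono inf_le_right))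
    rintro _ ⟨⟨x, hx, rfl⟩, hx'⟩
    exact mem_map_of_mem ⟨hx, mem_of_mkQ_mem_map ha.2 hx'⟩
  have hLP := linked_map (U := ⊤) ha inf_le_left le_top hP hPu
  have hLQ := linked_map (U := ⊤) ha inf_le_right le_top hQ hQu
  rw [← hinf] at hLP hLQ
  obtain ⟨_, x, hx, _, hxz⟩ := hE.mem_of_linked hLP hLQ (by
    rintro _ ⟨_, x, hx, _, rfl⟩ hxs
    rw [← Submodule.map_sup] at hxs
    exact (hs x hx (mem_of_mkQ_mem_map (mem_sup_left ha.1) hxs)).imp (fun h => mem_map_of_mem h)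
      (fun h => mem_map_of_mem h)) (mkQ (span (ZMod 2) {a}) z) (hinf ▸ mem_map_of_mem hz) (by
    rw [Ne, mkQ_apply, Submodule.Quotient.mk_eq_zero, mem_span_singleton_iff]
    exact not_or.2 ⟨hz0, hza⟩)
  rcases mkQ_eq_iff.1 hxz with rfl | rfl
  · exact Or.inl hx
  · exact Or.inr hx

lemma exists_add_mem_of_linked {E : Set V} {U Z : Submodule (ZMod 2) V} {a : V}
    (hE : VChordal (contr E U a)) (ha : a ∈ Z) (hZU : Z ≤ U)
    (hZ : Z ≤ span (ZMod 2) {x | x ∈ E ∧ x ∈ Z} ⊔ span (ZMod 2) {a})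
    (hU : U ≤ span (ZMod 2) {x | x ∈ E ∧ x ∈ U ∧ x ∉ Z} ⊔ span (ZMod 2) {a})
    (hu : Unsep E U Z) {e : V} (he : e ∈ E) (heZ : e ∈ Z) (he0 : e ≠ 0) (hea : e ≠ a) :
    ∃ u ∈ E, u ∈ U ∧ u ∉ Z ∧ ∃ v ∈ E, v ∈ U ∧ (v = e + u ∨ v = e + u + a) := by
  have hL := linked_map ha hZU le_rfl hU hu
  have hsp : span (ZMod 2) (contr E U a) = U.map (mkQ (span (ZMod 2) {a})) := by
    refine le_antisymm (span_le.2 ?_) (hL.1.trans (span_mono fun x hx => hx.1))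
    rintro _ ⟨_, x, _, hx, rfl⟩
    exact mem_map_of_mem hx
  have hne : mkQ (span (ZMod 2) {a}) e ≠ 0 := by
    rw [Ne, mkQ_apply, Submodule.Quotient.mk_eq_zero, mem_span_singleton_iff]
    exact not_or.2 ⟨he0, hea⟩
  rw [← hsp] at hL
  obtain ⟨_, ⟨_, u, hu, huU, rfl⟩, huZ, _, v, hv, hvU, hvu⟩ := hE.exists_add_mem
    (Z := Z.map (mkQ (span (ZMod 2) {a}))) (by
      refine (map_mono hZ).trans ?_
      rw [Submodule.map_sup, mkQ_map_self, sup_bot_eq, map_span, span_le]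
      rintro _ ⟨x, ⟨hx, hxZ⟩, rfl⟩
      by_cases h0 : mkQ (span (ZMod 2) {a}) x = 0
      · rw [h0]; exact zero_mem _
      · exact subset_span ⟨⟨h0, x, hx, hZU hxZ, rfl⟩, mem_map_of_mem hxZ⟩) hL
    (mkQ (span (ZMod 2) {a}) e) ⟨hne, e, he, hZU heZ, rfl⟩ (mem_map_of_mem heZ)
  rw [← map_add] at hvu
  exact ⟨u, hu, huU, fun h => huZ (mem_map_of_mem h), v, hv, hvU, mkQ_eq_iff.1 hvu⟩

/-- A part of `X` over `Z` that cannot be separated further. -/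
lemma exists_unsep [Module.Finite (ZMod 2) V] {E : Set V} {P Z : Submodule (ZMod 2) V}
    (hZP : Z ≤ P) (hE : ∃ x ∈ E, x ∈ P ∧ x ∉ Z) :
    ∃ T T' : Submodule (ZMod 2) V, Z ≤ T ∧ Z ≤ T' ∧ T ≤ P ∧ T' ≤ P ∧ T ⊓ T' ≤ Z ∧
      (∀ x ∈ E, x ∈ P → x ∈ T ∨ x ∈ T') ∧ (∃ x ∈ E, x ∈ P ∧ x ∉ T') ∧
      T ≤ span (ZMod 2) {x | x ∈ E ∧ x ∈ T ∧ x ∉ Z} ⊔ Z ∧ Unsep E T Z := by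
  let good : Submodule (ZMod 2) V → Prop := fun T => ∃ T', Z ≤ T ∧ Z ≤ T' ∧ T ≤ P ∧ T' ≤ P ∧
    T ⊓ T' ≤ Z ∧ (∀ x ∈ E, x ∈ P → x ∈ T ∨ x ∈ T') ∧ (∃ x ∈ E, x ∈ P ∧ x ∉ T')
  -- `T` is chosen minimal among the parts that can be split off from a `T'` missing some element of
  -- `E` in `P`.
  obtain ⟨T, ⟨T', h1, h2, h3, h4, h5, h6, h7⟩, hmin⟩ :=
    (wellFounded_lt (α := Submodule (ZMod 2) V)).has_min {T | good T}
      ⟨P, Z, hZP, le_rfl, le_rfl, hZP, inf_le_right, fun x _ hx => Or.inl hx, hE⟩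
  have hmin' : ∀ R, good R → R ≤ T → T ≤ R := fun R hR hRT =>
    not_lt_iff_le_imp_ge.1 (hmin R hR) hRT
  have hspan : T ≤ span (ZMod 2) {x | x ∈ E ∧ x ∈ T ∧ x ∉ Z} ⊔ Z := by
    have hle : span (ZMod 2) {x | x ∈ E ∧ x ∈ T ∧ x ∉ Z} ⊔ Z ≤ T :=
      sup_le (span_le.2 fun x hx => hx.2.1) h1
    refine hmin' _ ⟨T', le_sup_right, h2, hle.trans h3, h4, (inf_le_inf_right _ hle).trans h5,
      fun x hx hxP => ?_, h7⟩ hle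
    refine (h6 x hx hxP).imp_left fun hxT => ?_
    by_cases hxZ : x ∈ Z
    · exact mem_sup_right hxZ
    · exact mem_sup_left (subset_span ⟨hx, hxT, hxZ⟩)
  refine ⟨T, T', h1, h2, h3, h4, h5, h6, h7, hspan, ?_⟩
  intro U₁ U₂ k1 k2 k3 k4 k5 k6
  -- If `U₂ ⊔ T'` misses an element, `U₁` with `U₂ ⊔ T'` is again admissible and minimality gives `T
  -- ≤ U₁`. If not, the elements in `T` all lie in `U₂`.
  by_cases hc : ∃ x ∈ E, x ∈ P ∧ x ∉ U₂ ⊔ T'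
  · refine Or.inl (hmin' _ ⟨U₂ ⊔ T', k1, k2.trans le_sup_left, k3.trans h3,
      sup_le (k4.trans h3) h4, ?_, ?_, hc⟩ k3)
    · rintro x ⟨hx, hx'⟩
      obtain ⟨u, hu, t, ht, rfl⟩ := mem_sup.1 hx'
      have : t ∈ Z := h5 ⟨(T.add_mem_iff_right (k4 hu)).1 (k3 hx), ht⟩
      exact k5 ⟨hx, add_mem hu (k2 this)⟩
    · intro x hx hxP
      rcases h6 x hx hxP with h | h
      · exact (k6 x hx h).imp_right fun h => mem_sup_left h
      · exact Or.inr (mem_sup_right h)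
  · push Not at hc
    refine Or.inr (hspan.trans (sup_le (span_le.2 fun x hx => ?_) k2))
    obtain ⟨u, hu, t, ht, rfl⟩ := mem_sup.1 (hc x hx.1 (h3 hx.2.1))
    have : t ∈ Z := h5 ⟨(T.add_mem_iff_right (k4 hu)).1 hx.2.1, ht⟩
    exact add_mem hu (k2 this)

end BinaryChordal

/-! ### The two bad planes, and the round case. -/

namespace BinaryChordal

open Submodule

variable {V : Type*} [AddCommGroup V] [Module (ZMod 2) V]

lemma zmod_two_eq (c : ZMod 2) : c = 0 ∨ c = 1 := by
  revert c; decide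

lemma add_self_eq_zero' (x : V) : x + x = 0 := by
  have : (2 : ZMod 2) • x = 0 := by
    rw [show (2 : ZMod 2) = 0 from rfl, zero_smul]
  rwa [two_smul] at this

lemma add_eq_zero_iff_eq' {x y : V} : x + y = 0 ↔ x = y :=
  ⟨fun h => by rw [← add_zero x, ← add_self_eq_zero' y, ← add_assoc, h, zero_add],
    fun h => h ▸ add_self_eq_zero' x⟩

lemma add_add_cancel_self (x y : V) : x + (x + y) = y := by
  rw [← add_assoc, add_self_eq_zero', zero_add]

lemma mem_span_triple_iff {a b p x : V} : x ∈ span (ZMod 2) {a, b, p} ↔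
    x = 0 ∨ x = a ∨ x = b ∨ x = p ∨ x = a + b ∨ x = a + p ∨ x = b + p ∨ x = a + b + p := by
  rw [mem_span_triple]
  constructor
  · rintro ⟨α, β, γ, rfl⟩
    rcases zmod_two_eq α with rfl | rfl <;> rcases zmod_two_eq β with rfl | rfl <;>
      rcases zmod_two_eq γ with rfl | rfl <;> simp
  · rintro (rfl | rfl | rfl | rfl | rfl | rfl | rfl | rfl)
    · exact ⟨0, 0, 0, by simp⟩
    · exact ⟨1, 0, 0, by simp⟩
    · exact ⟨0, 1, 0, by simp⟩
    · exact ⟨0, 0, 1, by simp⟩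
    · exact ⟨1, 1, 0, by simp⟩
    · exact ⟨1, 0, 1, by simp⟩
    · exact ⟨0, 1, 1, by simp⟩
    · exact ⟨1, 1, 1, by simp⟩

lemma linearIndependent_triple_iff {a b p : V} : LinearIndependent (ZMod 2) ![a, b, p] ↔
    a ≠ 0 ∧ b ≠ 0 ∧ p ≠ 0 ∧ a + b ≠ 0 ∧ a + p ≠ 0 ∧ b + p ≠ 0 ∧ a + b + p ≠ 0 := by
  have key : LinearIndependent (ZMod 2) ![a, b, p] ↔
      ∀ α β γ : ZMod 2, α • a + β • b + γ • p = 0 → α = 0 ∧ β = 0 ∧ γ = 0 := by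
    rw [Fintype.linearIndependent_iff]
    constructor
    · intro h α β γ h0
      have := h ![α, β, γ] (by simpa [Fin.sum_univ_three] using h0)
      exact ⟨this 0, this 1, this 2⟩
    · intro h g h0 i
      obtain ⟨h1, h2, h3⟩ := h (g 0) (g 1) (g 2) (by simpa [Fin.sum_univ_three] using h0)
      fin_cases i <;> assumption
  rw [key]
  constructor
  · intro h
    refine ⟨?_, ?_, ?_, ?_, ?_, ?_, ?_⟩
    · exact fun h0 => absurd (h 1 0 0 (by simpa using h0)) (by decide)
    · exact fun h0 => absurd (h 0 1 0 (by simpa using h0)) (by decide)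
    · exact fun h0 => absurd (h 0 0 1 (by simpa using h0)) (by decide)
    · exact fun h0 => absurd (h 1 1 0 (by simpa using h0)) (by decide)
    · exact fun h0 => absurd (h 1 0 1 (by simpa using h0)) (by decide)
    · exact fun h0 => absurd (h 0 1 1 (by simpa using h0)) (by decide)
    · exact fun h0 => absurd (h 1 1 1 (by simpa using h0)) (by decide)
  · rintro ⟨h1, h2, h3, h4, h5, h6, h7⟩ α β γ h
    rcases zmod_two_eq α with rfl | rfl <;> rcases zmod_two_eq β with rfl | rfl <;>
      rcases zmod_two_eq γ with rfl | rfl <;> simp_all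

/-- Four vectors in a three-dimensional space whose sum is the only dependency. -/
def IsFourCircuit (E : Set V) : Prop :=
  ∃ a b p : V, LinearIndependent (ZMod 2) ![a, b, p] ∧ E = {a, a + p, b, b + p}

/-- A three-dimensional binary projective space without one point. -/
def IsFanoMinusPoint (E : Set V) : Prop :=
  ∃ a b p : V, LinearIndependent (ZMod 2) ![a, b, p] ∧
    E = {a, b, a + b, a + p, b + p, a + b + p}

lemma isFourCircuit_plane {E : Set V} {a b p : V} (h0 : (0 : V) ∉ E) (ha : a ∈ E) (hb : b ∈ E)
    (hap : a + p ∈ E) (hbp : b + p ∈ E) (hp : p ∉ E) (hp0 : p ≠ 0) (hab : a + b ∉ E)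
    (habp : a + b + p ∉ E) (hab0 : a + b ≠ 0) (habp0 : a + b + p ≠ 0) :
    IsFourCircuit {x | x ∈ E ∧ x ∈ span (ZMod 2) {a, b, p}} := by
  refine ⟨a, b, p, linearIndependent_triple_iff.2 ⟨?_, ?_, hp0, hab0, ?_, ?_, habp0⟩, ?_⟩
  · exact fun h => h0 (h ▸ ha)
  · exact fun h => h0 (h ▸ hb)
  · exact fun h => h0 (h ▸ hap)
  · exact fun h => h0 (h ▸ hbp)
  · ext x
    simp only [Set.mem_ofPred_eq, mem_span_triple_iff, Set.mem_insert_iff, Set.mem_singleton_iff]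
    constructor
    · rintro ⟨hx, rfl | rfl | rfl | rfl | rfl | rfl | rfl | rfl⟩ <;> simp_all
    · rintro (rfl | rfl | rfl | rfl) <;> simp_all

lemma isFanoMinusPoint_plane {E : Set V} {a b p : V} (h0 : (0 : V) ∉ E) (ha : a ∈ E) (hb : b ∈ E)
    (hab : a + b ∈ E) (hap : a + p ∈ E) (hbp : b + p ∈ E) (habp : a + b + p ∈ E) (hp : p ∉ E)
    (hp0 : p ≠ 0) : IsFanoMinusPoint {x | x ∈ E ∧ x ∈ span (ZMod 2) {a, b, p}} := by
  refine ⟨a, b, p, linearIndependent_triple_iff.2 ⟨?_, ?_, hp0, ?_, ?_, ?_, ?_⟩, ?_⟩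
  · exact fun h => h0 (h ▸ ha)
  · exact fun h => h0 (h ▸ hb)
  · exact fun h => h0 (h ▸ hab)
  · exact fun h => h0 (h ▸ hap)
  · exact fun h => h0 (h ▸ hbp)
  · exact fun h => h0 (h ▸ habp)
  · ext x
    simp only [Set.mem_ofPred_eq, mem_span_triple_iff, Set.mem_insert_iff, Set.mem_singleton_iff]
    constructor
    · rintro ⟨hx, rfl | rfl | rfl | rfl | rfl | rfl | rfl | rfl⟩ <;> simp_all
    · rintro (rfl | rfl | rfl | rfl | rfl | rfl) <;> simp_all

/-- A set of nonzero vectors that is not chordal, while its proper flats and the contractions of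
its flats are chordal. -/
structure MinNonchordal (E : Set V) : Prop where
  zero_notMem : (0 : V) ∉ E
  flat : ∀ U : Submodule (ZMod 2) V, (∃ x ∈ E, x ∉ U) → VChordal {x | x ∈ E ∧ x ∈ U}
  contract : ∀ (U : Submodule (ZMod 2) V) (a : V), a ∈ E → a ∈ U → VChordal (contr E U a)
  not_chordal : ¬ VChordal E

/-- `E` has a flat that is a circuit with four elements or a Fano plane without a point. -/
def HasBadPlane (E : Set V) : Prop :=
  ∃ U : Submodule (ZMod 2) V,
    IsFourCircuit {x | x ∈ E ∧ x ∈ U} ∨ IsFanoMinusPoint {x | x ∈ E ∧ x ∈ U}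

theorem MinNonchordal.hasBadPlane_of_round {E : Set V} (hE : MinNonchordal E) (hr : Round E) :
    HasBadPlane E := by
  -- A cover of the contraction pulls back to a cover of `E`, so the contraction is round, and being
  -- chordal it is full. Hence each class modulo `a`, other than the zero class, contains an
  -- element.
  have hz : ∀ a ∈ E, ∀ v ∈ span (ZMod 2) E, v ≠ 0 → v ≠ a → v ∈ E ∨ v + a ∈ E := by
    intro a ha v hv hv0 hva
    have hc := hE.contract ⊤ a ha mem_top
    have hround : Round (contr E ⊤ a) := by
      intro P Q hPQ
      have key : ∀ R : Submodule (ZMod 2) (V ⧸ span (ZMod 2) {a}),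
          (∀ x ∈ E, x ∈ R.comap (mkQ (span (ZMod 2) {a}))) → ∀ x ∈ contr E ⊤ a, x ∈ R := by
        rintro R h _ ⟨_, x, hx, _, rfl⟩
        exact h x hx
      refine (hr (P.comap (mkQ _)) (Q.comap (mkQ _)) fun x hx => ?_).imp (key P) (key Q)
      by_cases h0 : mkQ (span (ZMod 2) {a}) x = 0
      · exact Or.inl (by rw [mem_comap, h0]; exact zero_mem _)
      · exact hPQ _ ⟨h0, x, hx, mem_top, rfl⟩
    have hsp : (span (ZMod 2) E).map (mkQ (span (ZMod 2) {a})) ≤ span (ZMod 2) (contr E ⊤ a) := by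
      rw [map_span, span_le]
      rintro _ ⟨x, hx, rfl⟩
      by_cases h0 : mkQ (span (ZMod 2) {a}) x = 0
      · rw [h0]; exact zero_mem _
      · exact subset_span ⟨h0, x, hx, mem_top, rfl⟩
    obtain ⟨_, x, hx, _, hxv⟩ := hc.mem_of_round hround (mkQ (span (ZMod 2) {a}) v)
      (hsp (mem_map_of_mem hv)) (by
        rw [Ne, mkQ_apply, Submodule.Quotient.mk_eq_zero, mem_span_singleton_iff]
        exact not_or.2 ⟨hv0, hva⟩)
    rcases mkQ_eq_iff.1 hxv with rfl | rfl
    · exact Or.inl hx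
    · exact Or.inr hx
  obtain ⟨k, hk, hk0, hkE⟩ : ∃ k ∈ span (ZMod 2) E, k ≠ 0 ∧ k ∉ E := by
    by_contra! hc
    refine hE.not_chordal ?_
    have : E = {x | x ∈ span (ZMod 2) E ∧ x ≠ 0} := by
      ext x
      exact ⟨fun hx => ⟨subset_span hx, fun h => hE.zero_notMem (h ▸ hx)⟩, fun hx => hc x hx.1 hx.2⟩
    rw [this]
    exact VChordal.pg _
  -- the vectors of the span outside `E` form a subspace
  have hadd : ∀ p ∈ span (ZMod 2) E, ∀ q ∈ span (ZMod 2) E, p ∉ E → q ∉ E → p + q ∉ E := by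
    intro p hp q hq hpE hqE h
    by_cases hp0 : p = 0
    · rw [hp0, zero_add] at h; exact hqE h
    by_cases hpq : p = p + q
    · rw [← hpq] at h; exact hpE h
    rcases hz _ h p hp hp0 hpq with h | h
    · exact hpE h
    · rw [add_add_cancel_self] at h; exact hqE h
  have hadd' : ∀ p ∈ span (ZMod 2) E, ∀ x ∈ E, p ∉ E → x + p ∈ E := by
    intro p hp x hx hpE
    by_contra h
    have := hadd _ (add_mem (subset_span hx) hp) p hp h hpE
    rw [add_assoc, add_self_eq_zero', add_zero] at this
    exact this hx
  have hne : ∃ a, a ∈ E := by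
    by_contra! hc
    rw [Set.eq_empty_of_forall_notMem hc, span_empty, mem_bot] at hk
    exact hk0 hk
  obtain ⟨a, ha⟩ := hne
  by_cases hco : ∀ b ∈ E, a + b ∉ E
  · -- `E` is an affine space
    by_cases hk' : ∃ k' ∈ span (ZMod 2) E, k' ∉ E ∧ k' ≠ 0 ∧ k' ≠ k
    · obtain ⟨l, hl, hlE, hl0, hlk⟩ := hk'
      refine ⟨span (ZMod 2) {a, a + l, k}, Or.inl (isFourCircuit_plane hE.zero_notMem ha ?_ ?_ ?_
        hkE hk0 ?_ ?_ ?_ ?_)⟩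
      · exact hadd' l hl a ha hlE
      · exact hadd' k hk a ha hkE
      · exact hadd' k hk _ (hadd' l hl a ha hlE) hkE
      · rwa [add_add_cancel_self]
      · rw [add_add_cancel_self]; exact hadd l hl k hk hlE hkE
      · rwa [add_add_cancel_self]
      · rw [add_add_cancel_self]
        exact fun h => hlk (add_eq_zero_iff_eq'.1 h)
    -- With a single nonzero missing vector `k`, `E` would be `{a, a + k}`, which two
    -- one-dimensional subspaces cover, against roundness.
    · push Not at hk'
      exfalso
      have h2 : ∀ x ∈ E, x ∈ span (ZMod 2) {a} ∨ x ∈ span (ZMod 2) {a + k} := by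
        intro x hx
        by_cases hxa : a + x = 0
        · exact Or.inl (mem_span_singleton_iff.2 (Or.inr (add_eq_zero_iff_eq'.1 hxa).symm))
        · have := hk' (a + x) (add_mem (subset_span ha) (subset_span hx)) (hco x hx) hxa
          refine Or.inr (mem_span_singleton_iff.2 (Or.inr ?_))
          rw [← this, add_add_cancel_self]
      have hak := hadd' k hk a ha hkE
      rcases hr _ _ h2 with h | h
      · rcases mem_span_singleton_iff.1 (h _ hak) with h | h
        · exact hE.zero_notMem (h ▸ hak)
        · exact hk0 (add_eq_left.1 h)
      · rcases mem_span_singleton_iff.1 (h _ ha) with h | h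
        · exact hE.zero_notMem (h ▸ ha)
        · exact hk0 (left_eq_add.1 h)
  · push Not at hco
    obtain ⟨b, hb, hab⟩ := hco
    exact ⟨span (ZMod 2) {a, b, k}, Or.inr (isFanoMinusPoint_plane hE.zero_notMem ha hb hab
      (hadd' k hk a ha hkE) (hadd' k hk b hb hkE) (hadd' k hk _ hab hkE) hkE hk0)⟩

end BinaryChordal

/-! ### Minimum separations, and the case that is not round. -/

namespace BinaryChordal

open Submodule Module

variable {V : Type*} [AddCommGroup V] [Module (ZMod 2) V]

/-- `E` is covered by `P` and `Q`, but by neither of them. -/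
structure IsSep (E : Set V) (P Q : Submodule (ZMod 2) V) : Prop where
  cover : ∀ x ∈ E, x ∈ P ∨ x ∈ Q
  left : ∃ x ∈ E, x ∉ P
  right : ∃ x ∈ E, x ∉ Q

/-- A separation whose meet has minimum dimension, and whose first part has minimum dimension
among those. -/
structure IsMinSep (E : Set V) (P Q : Submodule (ZMod 2) V) : Prop extends IsSep E P Q where
  le_inf : ∀ P' Q', IsSep E P' Q' → finrank (ZMod 2) ↥(P ⊓ Q) ≤ finrank (ZMod 2) ↥(P' ⊓ Q')
  le_left : ∀ P' Q', IsSep E P' Q' → finrank (ZMod 2) ↥(P' ⊓ Q') ≤ finrank (ZMod 2) ↥(P ⊓ Q) →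
    finrank (ZMod 2) P ≤ finrank (ZMod 2) P'

lemma exists_isMinSep {E : Set V} (hE : ¬ Round E) : ∃ P Q, IsMinSep E P Q := by
  have h : ∃ p : Submodule (ZMod 2) V × Submodule (ZMod 2) V, IsSep E p.1 p.2 := by
    simp only [Round, not_forall, not_or] at hE
    obtain ⟨P, Q, h, ⟨x, hx, hxP⟩, y, hy, hyQ⟩ := hE
    exact ⟨(P, Q), h, ⟨x, hx, hxP⟩, ⟨y, hy, hyQ⟩⟩
  let f : Submodule (ZMod 2) V × Submodule (ZMod 2) V → ℕ ×ₗ ℕ := fun p =>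
    toLex (finrank (ZMod 2) ↥(p.1 ⊓ p.2), finrank (ZMod 2) p.1)
  obtain ⟨⟨P, Q⟩, hPQ, hmin⟩ := (InvImage.wf f wellFounded_lt).has_min
    {p | IsSep E p.1 p.2} h
  have hlt : ∀ P' Q', IsSep E P' Q' → ¬ (finrank (ZMod 2) ↥(P' ⊓ Q') < finrank (ZMod 2) ↥(P ⊓ Q) ∨
      finrank (ZMod 2) ↥(P' ⊓ Q') = finrank (ZMod 2) ↥(P ⊓ Q) ∧
        finrank (ZMod 2) P' < finrank (ZMod 2) P) :=
    fun P' Q' h' hl => hmin (P', Q') h' (Prod.Lex.toLex_lt_toLex.2 hl)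
  refine ⟨P, Q, hPQ, fun P' Q' h' => ?_, fun P' Q' h' hle => ?_⟩
  · have := hlt P' Q' h'; omega
  · have := hlt P' Q' h'; omega

/-- Otherwise `E` is the gluing of its flats in `P` and `Q`, which are proper and therefore chordal.
-/
lemma MinNonchordal.exists_inf_notMem {E : Set V} {P Q : Submodule (ZMod 2) V}
    (hE : MinNonchordal E) (h : IsSep E P Q) : ∃ p ∈ P ⊓ Q, p ≠ 0 ∧ p ∉ E := by
  by_contra! hc
  refine hE.not_chordal ?_
  have : E = {x | x ∈ E ∧ x ∈ P} ∪ {x | x ∈ E ∧ x ∈ Q} := by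
    ext x
    exact ⟨fun hx => (h.cover x hx).imp (⟨hx, ·⟩) (⟨hx, ·⟩), fun hx => hx.elim (·.1) (·.1)⟩
  rw [this]
  refine VChordal.glue _ _ (hE.flat P h.left) (hE.flat Q h.right) fun x hxP hxQ hx0 => ?_
  have hxP : x ∈ P := span_le.2 (fun y hy => hy.2) hxP
  have hxQ : x ∈ Q := span_le.2 (fun y hy => hy.2) hxQ
  exact ⟨⟨hc x ⟨hxP, hxQ⟩ hx0, hxP⟩, hc x ⟨hxP, hxQ⟩ hx0, hxQ⟩

/-- Prepares a part inside `Q` for the contraction of `a`. As `a` is off `Q`, adding it to `W`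
creates no new vectors in `Q`, so separations over `W ⊔ span {a}` restrict to separations over `W`.
-/
lemma linked_sup_singleton {E : Set V} {R W Q : Submodule (ZMod 2) V} {a : V} (hL : Linked E R W)
    (hWR : W ≤ R) (hRQ : R ≤ Q) (ha : a ∉ Q) :
    R ⊔ span (ZMod 2) {a} ≤ span (ZMod 2) {x | x ∈ E ∧ x ∈ R ⊔ span (ZMod 2) {a} ∧
      x ∉ W ⊔ span (ZMod 2) {a}} ⊔ span (ZMod 2) {a} ∧
    Unsep E (R ⊔ span (ZMod 2) {a}) (W ⊔ span (ZMod 2) {a}) := by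
  have hinf : ∀ x ∈ W ⊔ span (ZMod 2) {a}, x ∈ Q → x ∈ W := by
    intro x hx hxQ
    obtain ⟨w, hw, t, ht, rfl⟩ := mem_sup.1 hx
    rcases mem_span_singleton_iff.1 ht with rfl | rfl
    · rwa [add_zero]
    · exact absurd ((Q.add_mem_iff_right (hRQ (hWR hw))).1 hxQ) ha
  constructor
  · refine sup_le (hL.1.trans ((span_mono fun x hx => ?_).trans le_sup_left)) le_sup_right
    exact ⟨hx.1, mem_sup_left hx.2.1, fun h => hx.2.2 (hinf x h (hRQ hx.2.1))⟩
  · intro U₁ U₂ h1 h2 h3 h4 h5 h6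
    have haU : ∀ U, W ⊔ span (ZMod 2) {a} ≤ U → R ≤ U ⊓ R → R ⊔ span (ZMod 2) {a} ≤ U :=
      fun U hU hR => sup_le (hR.trans inf_le_left) (le_sup_right.trans hU)
    refine (hL.2 (U₁ ⊓ R) (U₂ ⊓ R) (le_inf (le_sup_left.trans h1) hWR)
      (le_inf (le_sup_left.trans h2) hWR) inf_le_right inf_le_right ?_ ?_).imp
        (haU _ h1) (haU _ h2)
    · exact fun x hx => hinf x (h5 ⟨hx.1.1, hx.2.1⟩) (hRQ hx.1.2)
    · exact fun x hx hxR => (h6 x hx (mem_sup_left hxR)).imp (⟨·, hxR⟩) (⟨·, hxR⟩)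

variable [Module.Finite (ZMod 2) V]

lemma IsMinSep.span_eq {E : Set V} {P Q : Submodule (ZMod 2) V} (h : IsMinSep E P Q) :
    span (ZMod 2) {x | x ∈ E ∧ x ∉ Q} = P := by
  have hle : span (ZMod 2) {x | x ∈ E ∧ x ∉ Q} ≤ P :=
    span_le.2 fun x hx => (h.cover x hx.1).resolve_right hx.2
  have hsep : IsSep E (span (ZMod 2) {x | x ∈ E ∧ x ∉ Q}) Q := by
    refine ⟨fun x hx => ?_, ?_, h.right⟩
    · by_cases hxQ : x ∈ Q
      · exact Or.inr hxQ
      · exact Or.inl (subset_span ⟨hx, hxQ⟩)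
    · obtain ⟨x, hx, hxP⟩ := h.left
      exact ⟨x, hx, fun h => hxP (hle h)⟩
  exact eq_of_le_of_finrank_le hle
    (h.le_left _ _ hsep (finrank_mono (inf_le_inf_right _ hle)))

/-- The second side of a minimum separation contains a part linked over the meet. -/
lemma IsMinSep.exists_linked {E : Set V} {P Q : Submodule (ZMod 2) V} (h : IsMinSep E P Q) :
    ∃ R ≤ Q, P ⊓ Q ≤ R ∧ Linked E R (P ⊓ Q) := by
  obtain ⟨x, hx, hxP⟩ := h.left
  obtain ⟨R, R', h1, h2, h3, h4, h5, h6, ⟨y, hy, hyQ, hyR⟩, h8, h9⟩ := exists_unsep (E := E)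
    (inf_le_right : P ⊓ Q ≤ Q) ⟨x, hx, (h.cover x hx).resolve_left hxP, fun h => hxP h.1⟩
  set S := span (ZMod 2) {x | x ∈ E ∧ x ∈ R ∧ x ∉ P ⊓ Q} with hS
  have hSR : S ≤ R := span_le.2 fun x hx => hx.2.1
  have hinf : (P ⊔ R') ⊓ Q ≤ R' := by
    rw [sup_comm, sup_inf_assoc_of_le P h4]
    exact sup_le le_rfl h2
  -- `S` and `P ⊔ R'` separate `E` with meet inside `P ⊓ Q`. Minimality makes the meets equal, so `P
  -- ⊓ Q ≤ S` and the elements off `P ⊓ Q` span all of `R`.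
  have hsep : IsSep E S (P ⊔ R') := by
    refine ⟨fun x hx => ?_, ?_, y, hy, fun hy' => hyR (hinf ⟨hy', hyQ⟩)⟩
    · by_cases hxP : x ∈ P
      · exact Or.inr (mem_sup_left hxP)
      · refine (h6 x hx ((h.cover x hx).resolve_left hxP)).imp (fun hxR => ?_) mem_sup_right
        exact subset_span ⟨hx, hxR, fun h => hxP h.1⟩
    · obtain ⟨x, hx, hxQ⟩ := h.right
      exact ⟨x, hx, fun h' => hxQ (h3 (hSR h'))⟩
  have hle : S ⊓ (P ⊔ R') ≤ P ⊓ Q := fun x hx => h5 ⟨hSR hx.1, hinf ⟨hx.2, h3 (hSR hx.1)⟩⟩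
  have heq := eq_of_le_of_finrank_le hle (h.le_inf _ _ hsep)
  exact ⟨R, h3, h1, h8.trans (sup_le le_rfl (heq.symm.le.trans inf_le_left)), h9⟩

/-- On the first side of a minimum separation there is an element `a` that, after contraction,
fills the meet enough to span it, and produces a new element `p` of the meet. -/
def HasGoodElement (E : Set V) (P Q : Submodule (ZMod 2) V) : Prop :=
  ∃ a ∈ E, a ∉ Q ∧ (∃ p ∈ P ⊓ Q, p ≠ 0 ∧ p ∉ E ∧ a + p ∈ E) ∧
    P ⊓ Q ≤ span (ZMod 2) {w | w ∈ P ⊓ Q ∧ (w ∈ E ∨ a + w ∈ E)}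

lemma MinNonchordal.hasGoodElement_of_coset {E : Set V} {P Q : Submodule (ZMod 2) V}
    (hE : MinNonchordal E) (h : IsMinSep E P Q) (hb : ¬ HasBadPlane E) {a : V}
    (ha : a ∈ E) (haQ : a ∉ Q) (hc : ∀ x ∈ E, x ∉ Q → a + x ∈ P ⊓ Q) : HasGoodElement E P Q := by
  -- For `b` in `E` off `Q`, the `w` in `P ⊓ Q` with `b + w` in `E` span `P ⊓ Q`, because the
  -- elements off `Q` span `P`.
  have hspan : ∀ b ∈ E, b ∉ Q → ∀ S : Submodule (ZMod 2) V, S ≤ P ⊓ Q →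
      (∀ w ∈ P ⊓ Q, b + w ∈ E → w ∈ S) → P ⊓ Q ≤ S := by
    intro b hbE hbQ S hS hbS w hw
    have hP : P ≤ S ⊔ span (ZMod 2) {b} := by
      rw [← h.span_eq, span_le]
      rintro x ⟨hx, hxQ⟩
      have hbx : b + x ∈ P ⊓ Q := by
        have := add_mem (hc b hbE hbQ) (hc x hx hxQ)
        rwa [show a + b + (a + x) = a + (a + (b + x)) by abel, add_add_cancel_self] at this
      rw [SetLike.mem_coe, ← add_add_cancel_self b x, add_comm]
      refine add_mem (mem_sup_left (hbS _ hbx ?_)) (mem_sup_right (mem_span_singleton_self b))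
      rwa [add_add_cancel_self]
    obtain ⟨s, hs, t, ht, rfl⟩ := mem_sup.1 (hP hw.1)
    rcases mem_span_singleton_iff.1 ht with rfl | rfl
    · rwa [add_zero]
    · exact absurd ((Q.add_mem_iff_right (hS hs).2).1 hw.2) hbQ
  obtain ⟨b, hbE, hbQ, p, hp, hp0, hpE, hbp⟩ : ∃ b ∈ E, b ∉ Q ∧
      ∃ p ∈ P ⊓ Q, p ≠ 0 ∧ p ∉ E ∧ b + p ∈ E := by
    by_contra! hno
    have hno' : ∀ b ∈ E, b ∉ Q → ∀ p ∈ P ⊓ Q, p ≠ 0 → b + p ∈ E → p ∈ E :=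
      fun b h1 h2 p h3 h4 h5 => by_contra fun h6 => hno b h1 h2 p h3 h4 h6 h5
    -- If no suitable `b` and `p` exist, the `w` with `a + w` in `E` form a subspace: a failure `v +
    -- w` would make the plane of `v`, `w`, `a` a Fano plane missing exactly `a + v + w`. By `hspan`
    -- this subspace is `P ⊓ Q`, whose nonzero vectors would then all be in `E`.
    let S : Submodule (ZMod 2) V :=
      { carrier := {w | w ∈ P ⊓ Q ∧ a + w ∈ E}
        add_mem' := by
          rintro v w ⟨hv, hav⟩ ⟨hw, haw⟩
          refine ⟨add_mem hv hw, ?_⟩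
          by_contra hvw
          rcases eq_or_ne v 0 with rfl | hv0
          · exact hvw (by rwa [zero_add])
          rcases eq_or_ne w 0 with rfl | hw0
          · exact hvw (by rwa [add_zero])
          have hvE := hno' a ha haQ v hv hv0 hav
          have hwE := hno' a ha haQ w hw hw0 haw
          have hvwE : v + w ∈ E := by
            refine hno' (a + v) hav (fun h => haQ ((Q.add_mem_iff_left hv.2).1 h)) (v + w)
              (add_mem hv hw) (fun h0 => ?_) ?_
            · rw [h0, add_zero] at hvw; exact hvw ha
            · rwa [add_assoc, add_add_cancel_self]
          refine hb ⟨span (ZMod 2) {v, w, a + v + w}, Or.inr (isFanoMinusPoint_plane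
            hE.zero_notMem hvE hwE hvwE ?_ ?_ ?_ (by rwa [add_assoc]) ?_)⟩
          · rwa [show v + (a + v + w) = v + (v + (a + w)) by abel, add_add_cancel_self]
          · rwa [show w + (a + v + w) = w + (w + (a + v)) by abel, add_add_cancel_self]
          · rwa [show v + w + (a + v + w) = (v + w) + (v + w + a) by abel, add_add_cancel_self]
          · intro h0
            refine haQ ?_
            rw [add_assoc] at h0
            exact add_eq_zero_iff_eq'.1 h0 ▸ add_mem hv.2 hw.2
        zero_mem' := ⟨zero_mem _, by rwa [add_zero]⟩
        smul_mem' := by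
          rintro c w ⟨hw, haw⟩
          rcases zmod_two_eq c with rfl | rfl
          · rw [zero_smul]; exact ⟨zero_mem _, by rwa [add_zero]⟩
          · rw [one_smul]; exact ⟨hw, haw⟩ }
    obtain ⟨p, hp, hp0, hpE⟩ := hE.exists_inf_notMem h.toIsSep
    have hpS : p ∈ S := hspan a ha haQ S (fun w hw => hw.1) (fun w hw haw => ⟨hw, haw⟩) hp
    exact hpE (hno' a ha haQ p hp hp0 hpS.2)
  refine ⟨b, hbE, hbQ, ⟨p, hp, hp0, hpE, hbp⟩, ?_⟩
  exact hspan b hbE hbQ _ (span_le.2 fun w hw => hw.1) fun w hw hbw => subset_span ⟨hw, Or.inr hbw⟩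

lemma finrank_sup_singleton_le (Z : Submodule (ZMod 2) V) (a : V) :
    finrank (ZMod 2) ↥(Z ⊔ span (ZMod 2) {a}) ≤ finrank (ZMod 2) Z + 1 := by
  have h1 := finrank_add_le_finrank_add_finrank Z (span (ZMod 2) {a})
  have h2 := finrank_span_le_card (R := ZMod 2) ({a} : Set V)
  rw [Set.toFinset_singleton, Finset.card_singleton] at h2
  omega

lemma finrank_sup_singleton {Z : Submodule (ZMod 2) V} {a : V} (ha : a ∉ Z) :
    finrank (ZMod 2) Z + 1 ≤ finrank (ZMod 2) ↥(Z ⊔ span (ZMod 2) {a}) :=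
  finrank_lt_finrank_of_lt (lt_of_le_of_ne le_sup_left
    fun h => ha (h ▸ mem_sup_right (mem_span_singleton_self a)))

/-- As `x₀` lies outside `P ⊓ Q ⊔ span {a}`, an unseparable part `T` of `P` exists over this
subspace. After contracting `a`, `T` and `R` are linked over the image of `P ⊓ Q`, so that image is
full: each nonzero `w` in `P ⊓ Q` has `w` or `a + w` in `E`. -/
lemma MinNonchordal.hasGoodElement_of_not_coset {E : Set V} {P Q R : Submodule (ZMod 2) V}
    (hE : MinNonchordal E) (h : IsMinSep E P Q) (hRQ : R ≤ Q) (hR : P ⊓ Q ≤ R)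
    (hL : Linked E R (P ⊓ Q)) {a x₀ : V} (ha : a ∈ E) (haQ : a ∉ Q) (hx₀ : x₀ ∈ E)
    (hx₀Q : x₀ ∉ Q) (hc : a + x₀ ∉ P ⊓ Q) : HasGoodElement E P Q := by
  have haP : a ∈ P := (h.cover a ha).resolve_right haQ
  set Z := P ⊓ Q ⊔ span (ZMod 2) {a} with hZ
  have haZ : a ∈ Z := mem_sup_right (mem_span_singleton_self a)
  have hZP : Z ≤ P := sup_le inf_le_left ((span_singleton_le_iff_mem _ _).2 haP)
  have hx₀Z : x₀ ∉ Z := by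
    intro hx
    obtain ⟨w, hw, t, ht, rfl⟩ := mem_sup.1 hx
    rcases mem_span_singleton_iff.1 ht with rfl | rfl
    · exact hx₀Q (by rw [add_zero]; exact hw.2)
    · refine hc ?_
      rwa [add_comm w, add_add_cancel_self]
  obtain ⟨T, T', h1, h2, h3, h4, h5, h6, ⟨y, hy, hyP, hyT⟩, h8, h9⟩ := exists_unsep (E := E)
    hZP ⟨x₀, hx₀, (h.cover x₀ hx₀).resolve_right hx₀Q, hx₀Z⟩
  set S := span (ZMod 2) {x | x ∈ E ∧ x ∈ T ∧ x ∉ Z} with hS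
  have hST : S ≤ T := span_le.2 fun x hx => hx.2.1
  have hinf : (Q ⊔ T') ⊓ P ≤ T' := by
    rw [sup_comm, sup_inf_assoc_of_le Q h4, inf_comm]
    exact sup_le le_rfl (le_sup_left.trans h2)
  have hsep : IsSep E S (Q ⊔ T') := by
    refine ⟨fun x hx => ?_, ?_, y, hy, fun hy' => hyT (hinf ⟨hy', hyP⟩)⟩
    · by_cases hxQ : x ∈ Q
      · exact Or.inr (mem_sup_left hxQ)
      · by_cases hxZ : x ∈ Z
        · exact Or.inr (mem_sup_right (h2 hxZ))
        · exact (h6 x hx ((h.cover x hx).resolve_right hxQ)).imp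
            (fun hxT => subset_span ⟨hx, hxT, hxZ⟩) mem_sup_right
    · obtain ⟨x, hx, hxP⟩ := h.left
      exact ⟨x, hx, fun h' => hxP (h3 (hST h'))⟩
  have hle : S ⊓ (Q ⊔ T') ≤ Z := fun x hx => h5 ⟨hST hx.1, hinf ⟨hx.2, h3 (hST hx.1)⟩⟩
  have hfr : finrank (ZMod 2) Z ≤ finrank (ZMod 2) ↥(P ⊓ Q) + 1 := finrank_sup_singleton_le _ _
  -- The meet of the new separation lies in `Z`, which has dimension at most one more than `P ⊓ Q`.
  -- If `a ∈ S`, a meet no larger than `P ⊓ Q` forces `S = P` by the choice of `P`, and a larger one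
  -- is all of `Z`. If `a ∉ S`, adding `a` to the meet raises its dimension and fills `Z`.
  have hW : P ⊓ Q ≤ S ⊔ span (ZMod 2) {a} := by
    by_cases haS : a ∈ S
    · by_cases hd : finrank (ZMod 2) ↥(S ⊓ (Q ⊔ T')) ≤ finrank (ZMod 2) ↥(P ⊓ Q)
      · have hSP := eq_of_le_of_finrank_le (hST.trans h3) (h.le_left _ _ hsep hd)
        rw [hSP]
        exact inf_le_left.trans le_sup_left
      · have heq := eq_of_le_of_finrank_le hle (by omega)
        exact (le_sup_left.trans (heq.symm.le.trans inf_le_left)).trans le_sup_left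
    · have hle' : S ⊓ (Q ⊔ T') ⊔ span (ZMod 2) {a} ≤ Z :=
        sup_le hle ((span_singleton_le_iff_mem _ _).2 haZ)
      have heq := eq_of_le_of_finrank_le hle' (by
        have := finrank_sup_singleton (Z := S ⊓ (Q ⊔ T')) fun h => haS h.1
        have := h.le_inf _ _ hsep
        omega)
      exact le_sup_left.trans (heq.symm.le.trans (sup_le_sup inf_le_left le_rfl))
  have hTfull : T ≤ S ⊔ span (ZMod 2) {a} :=
    h8.trans (sup_le le_sup_left (sup_le hW le_sup_right))
  have hLa := linked_sup_singleton hL hR hRQ haQ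
  rw [← hZ] at hLa
  have hTQ : T ⊓ Q ≤ R := (inf_le_inf_right _ h3).trans hR
  have hTR : T ⊓ (R ⊔ span (ZMod 2) {a}) = Z := by
    refine le_antisymm ?_ (le_inf h1 (sup_le_sup hR le_rfl))
    rintro x ⟨hxT, hx⟩
    obtain ⟨r, hr, t, ht, rfl⟩ := mem_sup.1 hx
    have htZ : t ∈ Z := mem_sup_right ht
    have hrT : r ∈ T := (T.add_mem_iff_left (h1 htZ)).1 hxT
    exact add_mem (mem_sup_left ⟨h3 hrT, hRQ hr⟩) htZ
  have hcov : ∀ x ∈ E, x ∈ T ⊔ (R ⊔ span (ZMod 2) {a}) → x ∈ T ∨ x ∈ R ⊔ span (ZMod 2) {a} := by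
    intro x hx hxs
    have hxs' : x ∈ T ⊔ R := (sup_le le_sup_left (sup_le le_sup_right
      (((span_singleton_le_iff_mem _ _).2 (h1 haZ)).trans le_sup_left))) hxs
    obtain ⟨t, ht, r, hr, rfl⟩ := mem_sup.1 hxs'
    rcases h.cover _ hx with hxP | hxQ
    · exact Or.inl (add_mem ht (h1 (mem_sup_left
        ⟨(P.add_mem_iff_right (h3 ht)).1 hxP, hRQ hr⟩)))
    · exact Or.inr (mem_sup_left (add_mem (hTQ ⟨ht, (Q.add_mem_iff_left (hRQ hr)).1 hxQ⟩) hr))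
  have hmain : ∀ w ∈ P ⊓ Q, w ≠ 0 → w ∈ E ∨ a + w ∈ E := by
    intro w hw hw0
    rw [add_comm a w]
    refine mem_or_add_mem_of_linked (P := T) (Q := R ⊔ span (ZMod 2) {a}) (hE.contract ⊤ a ha mem_top)
      (by rwa [hTR]) ?_ ?_ ?_ ?_ hcov ?_ hw0 fun h => haQ (h ▸ hw.2)
    · rwa [hTR]
    · rw [hTR]; exact hLa.1
    · rwa [hTR]
    · rw [hTR]; exact hLa.2
    · rw [hTR]; exact mem_sup_left hw
  obtain ⟨p, hp, hp0, hpE⟩ := hE.exists_inf_notMem h.toIsSep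
  refine ⟨a, ha, haQ, ⟨p, hp, hp0, hpE, (hmain p hp hp0).resolve_left hpE⟩, fun w hw => ?_⟩
  rcases eq_or_ne w 0 with rfl | hw0
  · exact zero_mem _
  · exact subset_span ⟨hw, hmain w hw hw0⟩

theorem MinNonchordal.hasBadPlane {E : Set V} (hE : MinNonchordal E) : HasBadPlane E := by
  by_cases hr : Round E
  · exact hE.hasBadPlane_of_round hr
  by_contra hb
  obtain ⟨P, Q, h⟩ := exists_isMinSep hr
  obtain ⟨R, hRQ, hR, hL⟩ := h.exists_linked
  have hgood : HasGoodElement E P Q := by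
    obtain ⟨a, ha, haQ⟩ := h.right
    by_cases hc : ∀ x ∈ E, x ∉ Q → a + x ∈ P ⊓ Q
    · exact hE.hasGoodElement_of_coset h hb ha haQ hc
    · push Not at hc
      obtain ⟨x, hx, hxQ, hax⟩ := hc
      exact hE.hasGoodElement_of_not_coset h hRQ hR hL ha haQ hx hxQ hax
  obtain ⟨a, ha, haQ, ⟨p, hp, hp0, hpE, hap⟩, hW⟩ := hgood
  have haP : a ∈ P := (h.cover a ha).resolve_right haQ
  have hLa := linked_sup_singleton hL hR hRQ haQ
  have haZ : a ∈ P ⊓ Q ⊔ span (ZMod 2) {a} := mem_sup_right (mem_span_singleton_self a)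
  have hZR : P ⊓ Q ⊔ span (ZMod 2) {a} ≤ R ⊔ span (ZMod 2) {a} := sup_le_sup hR le_rfl
  -- The element `a + p` represents `p` modulo `a`. Of the two possible values of `v`, only `u + p`
  -- survives: `v` is in `Q`, and `a + p + u` is not.
  obtain ⟨u, hu, huR, huZ, v, hv, hvR, huv⟩ := exists_add_mem_of_linked
    (hE.contract (R ⊔ span (ZMod 2) {a}) a ha (hZR haZ)) haZ hZR (by
      refine sup_le (hW.trans (span_le.2 fun w hw => ?_)) le_sup_right
      rcases hw.2 with h | h
      · exact mem_sup_left (subset_span ⟨h, mem_sup_left hw.1⟩)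
      · rw [SetLike.mem_coe, ← add_add_cancel_self a w, add_comm]
        exact add_mem (mem_sup_left (subset_span ⟨h, add_mem haZ (mem_sup_left hw.1)⟩))
          (mem_sup_right (mem_span_singleton_self a))) hLa.1 hLa.2 hap
    (add_mem haZ (mem_sup_left hp)) (fun h => hE.zero_notMem (h ▸ hap)) (fun h => hp0 (add_eq_left.1 h))
  have hnP : ∀ x ∈ R ⊔ span (ZMod 2) {a}, x ∉ P ⊓ Q ⊔ span (ZMod 2) {a} → x ∉ P := by
    intro x hx hxZ hxP
    obtain ⟨r, hr, t, ht, rfl⟩ := mem_sup.1 hx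
    have htP : t ∈ P := (span_singleton_le_iff_mem _ _).2 haP ht
    exact hxZ (add_mem (mem_sup_left ⟨(P.add_mem_iff_left htP).1 hxP, hRQ hr⟩) (mem_sup_right ht))
  have huP := hnP u huR huZ
  have huQ := (h.cover u hu).resolve_left huP
  have hvZ : v ∉ P ⊓ Q ⊔ span (ZMod 2) {a} := by
    intro hvZ
    have hapZ : a + p ∈ P ⊓ Q ⊔ span (ZMod 2) {a} := add_mem haZ (mem_sup_left hp)
    rcases huv with rfl | rfl
    · exact huZ ((Submodule.add_mem_iff_right _ hapZ).1 hvZ)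
    · exact huZ ((Submodule.add_mem_iff_right _ hapZ).1 ((Submodule.add_mem_iff_left _ haZ).1 hvZ))
  have hvQ := (h.cover v hv).resolve_left (hnP v hvR hvZ)
  have hup : u + p ∈ E := by
    rcases huv with rfl | rfl
    · rw [add_assoc] at hvQ
      exact absurd ((Q.add_mem_iff_left (add_mem hp.2 huQ)).1 hvQ) haQ
    · rwa [show a + p + u + a = a + (a + (u + p)) by abel, add_add_cancel_self] at hv
  -- The points `a + u` and `a + u + p` are in neither `P` nor `Q`.
  have hout : ∀ x, a + u + x ∈ E → x ∈ P ⊓ Q → False := by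
    intro x hx hxW
    rcases h.cover _ hx with h | h
    · exact huP ((P.add_mem_iff_right haP).1 ((P.add_mem_iff_left hxW.1).1 h))
    · exact haQ ((Q.add_mem_iff_left huQ).1 ((Q.add_mem_iff_left hxW.2).1 h))
  have hout0 : ∀ x, a + u + x = 0 → x ∈ P ⊓ Q → False := by
    intro x hx hxW
    have : a + u + x ∈ P := hx ▸ zero_mem _
    exact huP ((P.add_mem_iff_right haP).1 ((P.add_mem_iff_left hxW.1).1 this))
  refine hb ⟨span (ZMod 2) {a, u, p}, Or.inl (isFourCircuit_plane hE.zero_notMem ha hu hap hup hpE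
    hp0 (fun h => hout 0 (by rwa [add_zero]) (zero_mem _)) (fun h => hout p h hp)
    (fun h => hout0 0 (by rwa [add_zero]) (zero_mem _)) (fun h => hout0 p h hp))⟩

end BinaryChordal

/-! ### The bad planes are not chordal; rank at most two is always chordal. -/

namespace BinaryChordal

open Submodule Module

section vectors

variable {V : Type*} [AddCommGroup V] [Module (ZMod 2) V]

lemma mem_span_pair_iff {a b x : V} : x ∈ span (ZMod 2) {a, b} ↔
    x = 0 ∨ x = a ∨ x = b ∨ x = a + b := by
  rw [mem_span_pair]
  constructor
  · rintro ⟨α, β, rfl⟩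
    rcases zmod_two_eq α with rfl | rfl <;> rcases zmod_two_eq β with rfl | rfl <;> simp
  · rintro (rfl | rfl | rfl | rfl)
    · exact ⟨0, 0, by simp⟩
    · exact ⟨1, 0, by simp⟩
    · exact ⟨0, 1, by simp⟩
    · exact ⟨1, 1, by simp⟩

lemma linked_line {E : Set V} {Q : Submodule (ZMod 2) V} {a p : V} (ha : a ∈ E) (hap : a + p ∈ E)
    (haQ : a ∉ Q) (hp : p ∈ Q) : Linked E (span (ZMod 2) {a, p}) (span (ZMod 2) {a, p} ⊓ Q) := by
  have haP : a ∈ span (ZMod 2) {a, p} := subset_span (by simp)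
  have hpP : p ∈ span (ZMod 2) {a, p} := subset_span (by simp)
  have hapQ : a + p ∉ Q := fun h => haQ ((Q.add_mem_iff_left hp).1 h)
  constructor
  · have h1 := subset_span (R := ZMod 2) (s := {x | x ∈ E ∧ x ∈ span (ZMod 2) {a, p} ∧
      x ∉ span (ZMod 2) {a, p} ⊓ Q}) ⟨ha, haP, fun h => haQ h.2⟩
    have h2 := subset_span (R := ZMod 2) (s := {x | x ∈ E ∧ x ∈ span (ZMod 2) {a, p} ∧
      x ∉ span (ZMod 2) {a, p} ⊓ Q}) ⟨hap, add_mem haP hpP, fun h => hapQ h.2⟩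
    rw [span_le, Set.insert_subset_iff, Set.singleton_subset_iff]
    exact ⟨h1, (Submodule.add_mem_iff_right _ h1).1 h2⟩
  · intro U₁ U₂ h1 h2 _ _ _ h3
    have key : ∀ U, span (ZMod 2) {a, p} ⊓ Q ≤ U → a ∈ U → span (ZMod 2) {a, p} ≤ U := by
      intro U hU haU
      rw [span_le, Set.insert_subset_iff, Set.singleton_subset_iff]
      exact ⟨haU, hU ⟨hpP, hp⟩⟩
    exact (h3 a ha haP).imp (key _ h1) (key _ h2)

/-- The lines through `a, p` and `b, p` cover the circuit and are linked over their meet. That meet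
contains `p`, which is not in the circuit. -/
lemma IsFourCircuit.not_vchordal {E : Set V} (h : IsFourCircuit E) : ¬ VChordal E := by
  obtain ⟨a, b, p, hi, rfl⟩ := h
  obtain ⟨ha, hb, hp, hab, hap, hbp, habp⟩ := linearIndependent_triple_iff.1 hi
  intro hE
  have haQ : a ∉ span (ZMod 2) {b, p} := by
    rw [mem_span_pair_iff]
    rintro (h | h | h | h)
    · exact ha h
    · exact hab (add_eq_zero_iff_eq'.2 h)
    · exact hap (add_eq_zero_iff_eq'.2 h)
    · exact habp (by rw [add_assoc]; exact add_eq_zero_iff_eq'.2 h)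
  have hbP : b ∉ span (ZMod 2) {a, p} := by
    rw [mem_span_pair_iff]
    rintro (h | h | h | h)
    · exact hb h
    · exact hab (add_eq_zero_iff_eq'.2 h.symm)
    · exact hbp (add_eq_zero_iff_eq'.2 h)
    · exact habp (by rw [h, add_right_comm, add_self_eq_zero'])
  have hpP : p ∈ span (ZMod 2) {a, p} := subset_span (by simp)
  have hpQ : p ∈ span (ZMod 2) {b, p} := subset_span (by simp)
  have haP : a ∈ span (ZMod 2) {a, p} := subset_span (by simp)
  have hbQ : b ∈ span (ZMod 2) {b, p} := subset_span (by simp)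
  have := hE.mem_of_linked (linked_line (by simp) (by simp) haQ hpQ)
    (inf_comm (span (ZMod 2) {b, p}) _ ▸ linked_line (by simp) (by simp) hbP hpP)
    (by
      rintro x (rfl | rfl | rfl | rfl) _
      · exact Or.inl haP
      · exact Or.inl (add_mem haP hpP)
      · exact Or.inr hbQ
      · exact Or.inr (add_mem hbQ hpQ)) p ⟨hpP, hpQ⟩ hp
  rcases this with h | h | h | h
  · exact hap (add_eq_zero_iff_eq'.2 h.symm)
  · exact ha (right_eq_add.1 h)
  · exact hbp (add_eq_zero_iff_eq'.2 h.symm)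
  · exact hb (right_eq_add.1 h)

/-- The set is round and spans the missing point `p`. For roundness, `e` off `P` and `f` off `Q`
must satisfy `e = f + p`, since otherwise `e + f` is an uncovered element; a third element `x` then
gives `x + e` off `P` as well, a contradiction. -/
lemma IsFanoMinusPoint.not_vchordal {E : Set V} (h : IsFanoMinusPoint E) : ¬ VChordal E := by
  obtain ⟨a, b, p, hi, hEq⟩ := h
  obtain ⟨ha, hb, hp, hab, hap, hbp, habp⟩ := linearIndependent_triple_iff.1 hi
  have hmem : ∀ x, x ∈ E ↔ x ∈ span (ZMod 2) {a, b, p} ∧ x ≠ 0 ∧ x ≠ p := by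
    intro x
    have h1 : a ≠ p := fun h => hap (add_eq_zero_iff_eq'.2 h)
    have h2 : b ≠ p := fun h => hbp (add_eq_zero_iff_eq'.2 h)
    have h3 : a + b ≠ p := fun h => habp (add_eq_zero_iff_eq'.2 h)
    rw [hEq, mem_span_triple_iff]
    simp only [Set.mem_insert_iff, Set.mem_singleton_iff]
    constructor
    · rintro (rfl | rfl | rfl | rfl | rfl | rfl) <;> simp_all
    · rintro ⟨rfl | rfl | rfl | rfl | rfl | rfl | rfl | rfl, h4, h5⟩ <;> simp_all
  have haE : a ∈ E := by rw [hEq]; simp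
  have hbE : b ∈ E := by rw [hEq]; simp
  have hadd : ∀ x ∈ E, ∀ y ∈ E, x ≠ y → x ≠ y + p → x + y ∈ E := by
    intro x hx y hy h1 h2
    refine (hmem _).2 ⟨add_mem ((hmem x).1 hx).1 ((hmem y).1 hy).1, ?_, ?_⟩
    · exact fun h => h1 (add_eq_zero_iff_eq'.1 h)
    · exact fun h => h2 (by rw [← h, add_comm x, add_add_cancel_self])
  have hthird : ∀ e ∈ E, ∃ x ∈ E, x ≠ e ∧ x ≠ e + p := by
    intro e _
    by_cases he : a = e ∨ a = e + p
    · refine ⟨b, hbE, ?_, ?_⟩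
      · rintro rfl
        rcases he with rfl | rfl
        · exact hab (add_self_eq_zero' _)
        · exact habp (by rw [add_assoc, add_self_eq_zero'])
      · rintro rfl
        rcases he with rfl | rfl
        · exact habp (by rw [← add_assoc, add_self_eq_zero', zero_add, add_self_eq_zero'])
        · exact hab (add_self_eq_zero' _)
    · exact ⟨a, haE, not_or.1 he⟩
  have hround : Round E := by
    intro P Q hPQ
    by_contra! hc
    obtain ⟨⟨e, he, heP⟩, f, hf, hfQ⟩ := hc
    have key : ∀ e ∈ E, e ∉ P → ∀ f ∈ E, f ∉ Q → e = f + p := by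
      intro e he heP f hf hfQ
      have heQ := (hPQ e he).resolve_left heP
      have hfP := (hPQ f hf).resolve_right hfQ
      by_contra h
      rcases hPQ _ (hadd e he f hf (fun h => heP (h ▸ hfP)) h) with h | h
      · exact heP ((P.add_mem_iff_left hfP).1 h)
      · exact hfQ ((Q.add_mem_iff_right heQ).1 h)
    obtain ⟨x, hx, hxe, hxp⟩ := hthird e he
    have hef := key e he heP f hf hfQ
    have hxP : x ∈ P := by
      by_contra h
      exact hxe ((key x hx h f hf hfQ).trans hef.symm)
    have := key (x + e) (hadd x hx e he hxe hxp) (fun h => heP ((P.add_mem_iff_right hxP).1 h))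
      f hf hfQ
    rw [← hef] at this
    exact ((hmem x).1 hx).2.1 (add_eq_right.1 this)
  intro hE
  have := hE.mem_of_round hround p ?_ hp
  · exact ((hmem p).1 this).2.2 rfl
  · have h1 : a + p ∈ E := by rw [hEq]; simp
    rw [← add_add_cancel_self a p]
    exact add_mem (subset_span haE) (subset_span h1)

lemma mem_of_mem_span_of_add_mem {E : Set V} (h : ∀ x ∈ E, ∀ y ∈ E, x ≠ y → x + y ∈ E) {x : V}
    (hx : x ∈ span (ZMod 2) E) (hx0 : x ≠ 0) : x ∈ E := by
  let U : Submodule (ZMod 2) V :=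
    { carrier := insert 0 E
      add_mem' := by
        rintro x y (rfl | hx) (rfl | hy)
        · simp
        · simp [hy]
        · simp [hx]
        · by_cases hxy : x = y
          · rw [hxy, add_self_eq_zero']; exact Or.inl rfl
          · exact Or.inr (h x hx y hy hxy)
      zero_mem' := Or.inl rfl
      smul_mem' := by
        intro c x hx
        rcases zmod_two_eq c with rfl | rfl
        · rw [zero_smul]; exact Or.inl rfl
        · rwa [one_smul] }
  have hle : span (ZMod 2) E ≤ U := span_le.2 fun x hx => Or.inr hx
  exact (hle hx).resolve_left hx0

lemma vchordal_of_add_mem {E : Set V} (h0 : (0 : V) ∉ E)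
    (h : ∀ x ∈ E, ∀ y ∈ E, x ≠ y → x + y ∈ E) : VChordal E := by
  have : E = {x | x ∈ span (ZMod 2) E ∧ x ≠ 0} := by
    ext x
    exact ⟨fun hx => ⟨subset_span hx, fun h => h0 (h ▸ hx)⟩,
      fun hx => mem_of_mem_span_of_add_mem h hx.1 hx.2⟩
  rw [this]
  exact VChordal.pg _

/-- Either `E` is closed under sums of distinct elements and hence full, or two elements `x`, `y`
with `x + y` missing already span, and `E` is two points glued along the zero space. -/
lemma vchordal_of_finrank_le [Module.Finite (ZMod 2) V] {E : Set V} (h0 : (0 : V) ∉ E)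
    (h : finrank (ZMod 2) (span (ZMod 2) E) ≤ 2) : VChordal E := by
  by_cases hc : ∀ x ∈ E, ∀ y ∈ E, x ≠ y → x + y ∈ E
  · exact vchordal_of_add_mem h0 hc
  push Not at hc
  obtain ⟨x, hx, y, hy, hxy, hxyE⟩ := hc
  have hx0 : x ≠ 0 := fun h => h0 (h ▸ hx)
  have hy0 : y ≠ 0 := fun h => h0 (h ▸ hy)
  have hi : LinearIndependent (ZMod 2) ![x, y] := by
    rw [LinearIndependent.pair_iff]
    intro s t hst
    rcases zmod_two_eq s with rfl | rfl <;> rcases zmod_two_eq t with rfl | rfl <;>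
      simp_all [add_eq_zero_iff_eq']
  have hle : span (ZMod 2) {x, y} ≤ span (ZMod 2) E :=
    span_mono (Set.insert_subset hx (Set.singleton_subset_iff.2 hy))
  have hfr : finrank (ZMod 2) (span (ZMod 2) {x, y}) = 2 := by
    have := finrank_span_eq_card hi
    rwa [Matrix.range_cons, Matrix.range_cons, Matrix.range_empty, Set.union_empty,
      Set.singleton_union, Fintype.card_fin] at this
  have heq := eq_of_le_of_finrank_le hle (by omega)
  have hE : E = {x} ∪ {y} := by
    ext z
    constructor
    · intro hz
      have hz' : z ∈ span (ZMod 2) {x, y} := heq ▸ subset_span hz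
      rcases mem_span_pair_iff.1 hz' with rfl | rfl | rfl | rfl
      · exact absurd hz h0
      · exact Or.inl rfl
      · exact Or.inr rfl
      · exact absurd hz hxyE
    · rintro (rfl | rfl) <;> assumption
  have hs : ∀ z : V, z ≠ 0 → VChordal ({z} : Set V) := fun z hz =>
    vchordal_of_add_mem (fun h => hz h.symm) (by
      rintro _ rfl _ rfl h
      exact absurd rfl h)
  rw [hE]
  refine VChordal.glue _ _ (hs x hx0) (hs y hy0) fun z hz hz' hz0 => ?_
  have h1 := (mem_span_singleton_iff.1 hz).resolve_left hz0
  have h2 := (mem_span_singleton_iff.1 hz').resolve_left hz0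
  exact absurd (h1.symm.trans h2) hxy

end vectors

end BinaryChordal

/-! ### Matroids and vectors: the two notions of chordality agree. -/

namespace BinaryChordal

open Submodule Module Set
open scoped Matroid

variable {α V : Type*} [AddCommGroup V] [Module (ZMod 2) V] {M : Matroid α} {φ : α → V}

/-- `φ` represents `M` over the two-element field. -/
def Rep (M : Matroid α) (φ : α → V) : Prop :=
  ∀ I ⊆ M.E, (M.Indep I ↔ LinearIndepOn (ZMod 2) φ I)

lemma Rep.restrict (h : Rep M φ) {R : Set α} (hR : R ⊆ M.E) : Rep (M ↾ R) φ := by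
  intro I hI
  rw [Matroid.restrict_indep_iff, h I (hI.trans hR)]
  exact and_iff_left hI

lemma Rep.mem_closure_iff_of_indep (h : Rep M φ) {I : Set α} (hI : M.Indep I) {e : α}
    (he : e ∈ M.E) : e ∈ M.closure I ↔ φ e ∈ span (ZMod 2) (φ '' I) := by
  by_cases heI : e ∈ I
  · exact iff_of_true (M.mem_closure_of_mem heI hI.subset_ground)
      (subset_span (mem_image_of_mem φ heI))
  · rw [← not_iff_not, hI.notMem_closure_iff_of_notMem heI he,
      h _ (insert_subset he hI.subset_ground), linearIndepOn_insert heI,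
      and_iff_right ((h I hI.subset_ground).1 hI)]

lemma Rep.span_basis (h : Rep M φ) {I X : Set α} (hI : M.IsBasis I X) :
    span (ZMod 2) (φ '' I) = span (ZMod 2) (φ '' X) := by
  refine le_antisymm (span_mono (image_mono hI.subset)) (span_le.2 ?_)
  rintro _ ⟨x, hx, rfl⟩
  exact (h.mem_closure_iff_of_indep hI.indep (hI.subset_ground hx)).1 (hI.subset_closure hx)

lemma Rep.mem_closure_iff (h : Rep M φ) {X : Set α} (hX : X ⊆ M.E) {e : α} (he : e ∈ M.E) :
    e ∈ M.closure X ↔ φ e ∈ span (ZMod 2) (φ '' X) := by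
  obtain ⟨I, hI⟩ := M.exists_isBasis X
  rw [← hI.closure_eq_closure, h.mem_closure_iff_of_indep hI.indep he, h.span_basis hI]

lemma Rep.isFlat_iff (h : Rep M φ) {F : Set α} : M.IsFlat F ↔
    F ⊆ M.E ∧ ∀ e ∈ M.E, φ e ∈ span (ZMod 2) (φ '' F) → e ∈ F := by
  constructor
  · intro hF
    refine ⟨hF.subset_ground, fun e he hs => ?_⟩
    rw [← hF.closure]
    exact (h.mem_closure_iff hF.subset_ground he).2 hs
  · rintro ⟨hFE, hF⟩
    rw [Matroid.isFlat_iff_closure_eq]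
    refine Subset.antisymm (fun e he => ?_) (M.subset_closure F)
    have heE := Matroid.mem_ground_of_mem_closure he
    exact hF e heE ((h.mem_closure_iff hFE heE).1 he)

lemma Rep.eRk_eq [Module.Finite (ZMod 2) V] (h : Rep M φ) {X : Set α} (hX : X ⊆ M.E) :
    M.eRk X = finrank (ZMod 2) (span (ZMod 2) (φ '' X)) := by
  obtain ⟨I, hI⟩ := M.exists_isBasis X
  have hi : LinearIndepOn (ZMod 2) φ I := (h I (hI.indep.subset_ground)).1 hI.indep
  have hfin : I.Finite := hi.finite
  have := hfin.fintype
  have h1 := finrank_span_eq_card hi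
  rw [← hI.encard_eq_eRk, ← h.span_basis hI, image_eq_range, h1, encard_eq_coe_toFinset_card,
    toFinset_card]

lemma Rep.simple_iff (h : Rep M φ) :
    M.IsSimpleMatroid ↔ InjOn φ M.E ∧ ∀ e ∈ M.E, φ e ≠ 0 := by
  constructor
  · intro hs
    refine ⟨fun e he f hf hef => ?_, fun e he => ?_⟩
    · exact ((h _ (pair_subset he hf)).1 (hs he hf)).injOn (mem_insert _ _)
        (mem_insert_of_mem _ rfl) hef
    · exact ((h _ (pair_subset he he)).1 (hs he he)).ne_zero (mem_insert _ _)
  · rintro ⟨hi, h0⟩ e f he hf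
    rw [h _ (pair_subset he hf)]
    by_cases hef : e = f
    · rw [hef, pair_eq_singleton, linearIndepOn_singleton_iff]
      exact h0 f hf
    · rw [linearIndepOn_insert (by simpa using hef), linearIndepOn_singleton_iff, image_singleton,
        mem_span_singleton_iff]
      exact ⟨h0 f hf, fun h' => h'.elim (h0 e he) fun h' => hef (hi he hf h')⟩

lemma Rep.isFlat_preimage (h : Rep M φ) (U : Submodule (ZMod 2) V) :
    M.IsFlat {e | e ∈ M.E ∧ φ e ∈ U} := by
  refine h.isFlat_iff.2 ⟨fun e he => he.1, fun e he hs => ⟨he, ?_⟩⟩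
  refine span_le.2 ?_ hs
  rintro _ ⟨f, hf, rfl⟩
  exact hf.2

/-- The nonzero vectors of a finite-dimensional binary space correspond to its points. -/
lemma mk_rep_eq {W : Type*} [AddCommGroup W] [Module (ZMod 2) W] (w : W) (hw : w ≠ 0) :
    (Projectivization.mk (ZMod 2) w hw).rep = w := by
  obtain ⟨u, hu⟩ := Projectivization.exists_smul_eq_mk_rep (ZMod 2) w hw
  rw [← hu, Subsingleton.elim u 1, one_smul]

lemma rep_mk_inj {W : Type*} [AddCommGroup W] [Module (ZMod 2) W] {v w : W} (hv : v ≠ 0)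
    (hw : w ≠ 0) (h : Projectivization.mk (ZMod 2) v hv = Projectivization.mk (ZMod 2) w hw) :
    v = w := by
  rw [← mk_rep_eq v hv, h, mk_rep_eq]

lemma Rep.isProjectiveGeometry [Module.Finite (ZMod 2) V] (h : Rep M φ) (hi : InjOn φ M.E)
    {U : Submodule (ZMod 2) V} (hU : φ '' M.E = {x | x ∈ U ∧ x ≠ 0}) :
    M.IsProjectiveGeometry (ZMod 2) := by
  have hmem : ∀ e ∈ M.E, φ e ∈ U ∧ φ e ≠ 0 := fun e he =>
    hU.subset (mem_image_of_mem φ he)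
  let f : U ≃ₗ[ZMod 2] (Fin (finrank (ZMod 2) U) → ZMod 2) :=
    (Module.finBasis (ZMod 2) U).equivFun
  let g : M.E → (Fin (finrank (ZMod 2) U) → ZMod 2) := fun e => f ⟨φ e, (hmem e e.2).1⟩
  have hg : ∀ e, g e ≠ 0 := fun e h0 => (hmem e e.2).2
    (congrArg Subtype.val ((LinearEquiv.map_eq_zero_iff f).1 h0))
  have hbij : Function.Bijective fun e => Projectivization.mk (ZMod 2) (g e) (hg e) := by
    constructor
    · intro e e' hee
      have := f.injective (rep_mk_inj _ _ hee)
      exact Subtype.ext (hi e.2 e'.2 (congrArg Subtype.val this))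
    · intro p
      induction p using Projectivization.ind with
      | h v hv =>
        have hmem' : ((f.symm v : U) : V) ∈ φ '' M.E := by
          rw [hU]
          refine ⟨(f.symm v).2, fun h0 => hv ?_⟩
          exact (LinearEquiv.map_eq_zero_iff f.symm).1 (Subtype.ext h0)
        obtain ⟨e, he, hev⟩ := hmem'
        refine ⟨⟨e, he⟩, ?_⟩
        have : g ⟨e, he⟩ = v := by
          simp only [g, hev, Subtype.coe_eta, LinearEquiv.apply_symm_apply]
        simp only [this]
  refine ⟨finrank (ZMod 2) U, Equiv.ofBijective _ hbij, fun I => ?_⟩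
  rw [h _ (by rintro _ ⟨e, _, rfl⟩; exact e.2), Projectivization.independent_iff]
  have h1 : Projectivization.rep ∘ (fun x : I => Equiv.ofBijective _ hbij (x : M.E)) =
      fun x : I => g x := by
    funext x
    exact mk_rep_eq _ _
  rw [h1]
  have h2 : LinearIndepOn (ZMod 2) φ (Subtype.val '' I) ↔
      LinearIndependent (ZMod 2) fun x : I => φ x := by
    exact (linearIndependent_equiv (Equiv.Set.image Subtype.val I Subtype.val_injective)).symm
  rw [h2]
  have h3 : (fun x : I => φ x) = (U.subtype ∘ₗ f.symm.toLinearMap) ∘ fun x : I => g x := by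
    funext x
    simp [g]
  rw [h3, LinearMap.linearIndependent_iff]
  rw [LinearMap.ker_eq_bot]
  exact U.subtype_injective.comp f.symm.injective

lemma Rep.exists_add_of_isProjectiveGeometry (h : Rep M φ) (hs : M.IsSimpleMatroid)
    (hM : M.IsProjectiveGeometry (ZMod 2)) : ∀ x ∈ φ '' M.E, ∀ y ∈ φ '' M.E, x ≠ y →
      x + y ∈ φ '' M.E := by
  obtain ⟨hi, h0⟩ := h.simple_iff.1 hs
  obtain ⟨r, E, hE⟩ := hM
  rintro _ ⟨e, he, rfl⟩ _ ⟨f, hf, rfl⟩ hef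
  set v := (E ⟨e, he⟩).rep with hv
  set w := (E ⟨f, hf⟩).rep with hw
  have hvw0 : v + w ≠ 0 := by
    intro h0
    refine hef (congrArg (fun x : M.E => φ x) (E.injective (a₁ := ⟨e, he⟩) (a₂ := ⟨f, hf⟩) ?_))
    rw [← Projectivization.mk_rep (E ⟨e, he⟩), ← Projectivization.mk_rep (E ⟨f, hf⟩)]
    congr 1
    exact add_eq_zero_iff_eq'.1 h0
  obtain ⟨⟨g, hg⟩, hgE⟩ := E.surjective (Projectivization.mk (ZMod 2) (v + w) hvw0)
  have hgr : (E ⟨g, hg⟩).rep = v + w := by rw [hgE, mk_rep_eq]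
  have hge : g ≠ e := by
    rintro rfl
    exact (E ⟨f, hf⟩).rep_nonzero (left_eq_add.1 hgr)
  have hgf : g ≠ f := by
    rintro rfl
    exact (E ⟨e, he⟩).rep_nonzero (right_eq_add.1 hgr)
  have hdep : ¬ M.Indep {g, e, f} := by
    have himg : ({g, e, f} : Set α) = Subtype.val '' ({⟨g, hg⟩, ⟨e, he⟩, ⟨f, hf⟩} : Set M.E) := by
      simp [image_insert_eq]
    rw [himg, hE, Projectivization.independent_iff]
    intro hl
    have hl' : LinearIndepOn (ZMod 2) (fun m : M.E => (E m).rep)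
      ({⟨g, hg⟩, ⟨e, he⟩, ⟨f, hf⟩} : Set M.E) := hl
    rw [linearIndepOn_insert (by simp [hge, hgf])] at hl'
    refine hl'.2 ?_
    simp only [hgr]
    exact add_mem (subset_span ⟨⟨e, he⟩, by simp, rfl⟩) (subset_span ⟨⟨f, hf⟩, by simp, rfl⟩)
  have hsub : ({e, f} : Set α) ⊆ M.E := pair_subset he hf
  rw [h _ (insert_subset hg hsub), linearIndepOn_insert (by simp [hge, hgf]),
    and_iff_right ((h _ hsub).1 (hs he hf)), not_not, image_pair, mem_span_pair_iff] at hdep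
  rcases hdep with h' | h' | h' | h'
  · exact absurd h' (h0 g hg)
  · exact absurd (hi hg he h') hge
  · exact absurd (hi hg hf h') hgf
  · exact ⟨g, hg, h'⟩

lemma isFlat_restrict_iff {T X : Set α} (hT : M.IsFlat T) :
    (M ↾ T).IsFlat X ↔ M.IsFlat X ∧ X ⊆ T := by
  have hcl : ∀ X ⊆ T, (M ↾ T).closure X = M.closure X := by
    intro X hX
    rw [Matroid.restrict_closure_eq M hX hT.subset_ground, inter_eq_left]
    exact (M.closure_subset_closure hX).trans hT.closure.le
  constructor
  · intro hX
    have hXT : X ⊆ T := hX.subset_ground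
    exact ⟨Matroid.isFlat_iff_closure_eq.2 (hcl X hXT ▸ hX.closure), hXT⟩
  · rintro ⟨hX, hXT⟩
    rw [Matroid.isFlat_iff_closure_eq, hcl X hXT, hX.closure]

lemma isFlat_inter_restrict {T X : Set α} (hT : T ⊆ M.E) (hX : M.IsFlat X) :
    (M ↾ T).IsFlat (X ∩ T) := by
  rw [Matroid.isFlat_iff_closure_eq, Matroid.restrict_closure_eq M inter_subset_right hT]
  refine Subset.antisymm (inter_subset_inter_left _ ?_) (subset_inter ?_ inter_subset_right)
  · exact (M.closure_subset_closure inter_subset_left).trans hX.closure.le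
  · exact M.subset_closure _ (inter_subset_right.trans hT)

lemma eq_of_isFlat_iff {M₁ M₂ : Matroid α} (hE : M₁.E = M₂.E)
    (h : ∀ X, M₁.IsFlat X ↔ M₂.IsFlat X) : M₁ = M₂ :=
  Matroid.ext_closure fun X => by simp only [Matroid.closure_def, hE, h]

lemma Rep.simple_restrict (hs : M.IsSimpleMatroid) {R : Set α} (hR : R ⊆ M.E) :
    (M ↾ R).IsSimpleMatroid := fun e f he hf => by
  rw [Matroid.restrict_indep_iff]
  exact ⟨hs (hR he) (hR hf), pair_subset he hf⟩

/-- Both parts of a generalized parallel connection across a projective geometry are flats of `M`,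
so they are represented by the same `φ`. The flats of `M` then force the two spans to meet only in
the span of the common part. -/
theorem Rep.vchordal [Module.Finite (ZMod 2) V] (hM : M.IsFieldChordal (ZMod 2)) :
    Rep M φ → M.IsSimpleMatroid → VChordal (φ '' M.E) := by
  induction hM with
  | projectiveGeometry M hM =>
    intro h hs
    refine vchordal_of_add_mem ?_ (h.exists_add_of_isProjectiveGeometry hs hM)
    rintro ⟨e, he, h0⟩
    exact (h.simple_iff.1 hs).2 e he h0
  | generalizedParallelConnection M M₁ M₂ N _ _ hN hM IH₁ IH₂ =>
    intro h hs
    set T := M₁.E ∩ M₂.E with hT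
    have hi := (h.simple_iff.1 hs).1
    have hE₁ : M₁.E ⊆ M.E := hM.ground_eq ▸ subset_union_left
    have hE₂ : M₂.E ⊆ M.E := hM.ground_eq ▸ subset_union_right
    have hT₁ : M₁.IsFlat T := hM.isModularFlat.1
    have hNN : M₁ ↾ T = M₂ ↾ T := hM.restrict_left.trans hM.restrict_right.symm
    -- A flat of `M₂` meets `T` in a flat of `M₂ ↾ T = M₁ ↾ T`, and hence in a flat of `M₁`, because
    -- `T` is a flat there.
    have hflat₂ : ∀ X ⊆ M₂.E, (M.IsFlat X ↔ M₂.IsFlat X) := by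
      intro X hX
      rw [hM.isFlat_iff X (hX.trans subset_union_right), inter_eq_left.2 hX, and_iff_right_iff_imp]
      intro hX₂
      have h1 := isFlat_inter_restrict (T := T) inter_subset_right hX₂
      rw [← hNN, isFlat_restrict_iff hT₁] at h1
      have h2 : X ∩ M₁.E = X ∩ T := by
        ext x; exact ⟨fun hx => ⟨hx.1, hx.2, hX hx.1⟩, fun hx => ⟨hx.1, hx.2.1⟩⟩
      exact h2 ▸ h1.1
    have hMF₂ : M.IsFlat M₂.E := (hflat₂ _ Subset.rfl).2 M₂.ground_isFlat
    have hM₂ : M₂ = M ↾ M₂.E := eq_of_isFlat_iff rfl fun X => by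
      rw [isFlat_restrict_iff hMF₂]
      exact ⟨fun hX => ⟨(hflat₂ X hX.subset_ground).2 hX, hX.subset_ground⟩,
        fun hX => (hflat₂ X hX.2).1 hX.1⟩
    have hrep₂ : Rep M₂ φ := hM₂ ▸ h.restrict hE₂
    have hs₂ : M₂.IsSimpleMatroid := hM₂ ▸ Rep.simple_restrict hs hE₂
    have hTM₂ : T ⊆ M₂.E := inter_subset_right
    have hTspan : ∀ x ∈ span (ZMod 2) (φ '' T), x ≠ 0 → x ∈ φ '' T := by
      have hN' : (M₂ ↾ T).IsProjectiveGeometry (ZMod 2) := hM.restrict_right ▸ hN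
      have := (hrep₂.restrict hTM₂).exists_add_of_isProjectiveGeometry
        (Rep.simple_restrict hs₂ hTM₂) hN'
      exact fun x hx hx0 => mem_of_mem_span_of_add_mem this hx hx0
    have hT₂ : M₂.IsFlat T := by
      refine hrep₂.isFlat_iff.2 ⟨hTM₂, fun e he hes => ?_⟩
      obtain ⟨t, ht, hte⟩ := hTspan _ hes ((h.simple_iff.1 hs).2 e (hE₂ he))
      rwa [← hi (hE₂ (hTM₂ ht)) (hE₂ he) hte]
    have hflat₁ : ∀ X ⊆ M₁.E, (M.IsFlat X ↔ M₁.IsFlat X) := by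
      intro X hX
      rw [hM.isFlat_iff X (hX.trans subset_union_left), inter_eq_left.2 hX, and_iff_left_iff_imp]
      intro hX₁
      have h1 := isFlat_inter_restrict (T := T) inter_subset_left hX₁
      rw [hNN, isFlat_restrict_iff hT₂] at h1
      have h2 : X ∩ M₂.E = X ∩ T := by
        ext x; exact ⟨fun hx => ⟨hx.1, hX hx.1, hx.2⟩, fun hx => ⟨hx.1, hx.2.2⟩⟩
      exact h2 ▸ h1.1
    have hMF₁ : M.IsFlat M₁.E := (hflat₁ _ Subset.rfl).2 M₁.ground_isFlat
    have hM₁ : M₁ = M ↾ M₁.E := eq_of_isFlat_iff rfl fun X => by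
      rw [isFlat_restrict_iff hMF₁]
      exact ⟨fun hX => ⟨(hflat₁ X hX.subset_ground).2 hX, hX.subset_ground⟩,
        fun hX => (hflat₁ X hX.2).1 hX.1⟩
    have hrep₁ : Rep M₁ φ := hM₁ ▸ h.restrict hE₁
    have hs₁ : M₁.IsSimpleMatroid := hM₁ ▸ Rep.simple_restrict hs hE₁
    rw [hM.ground_eq, image_union]
    refine VChordal.glue _ _ (IH₁ hrep₁ hs₁) (IH₂ hrep₂ hs₂) fun y hy₁ hy₂ hy0 => ?_
    suffices hyT : y ∈ φ '' T from
      ⟨image_mono inter_subset_left hyT, image_mono inter_subset_right hyT⟩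
    by_contra hyT
    -- A common vector `y` outside `T` is tested against a maximal span `H` of elements of `M₁` that
    -- contains `T` and avoids `y`. Any `e` of `M₁` off `H` equals `y` plus a vector of `H`, so it
    -- is in the span of the flat `F₁ ∪ M₂.E`, which does not contain it. Thus `H` contains all of
    -- `M₁`, and with it `y`.
    obtain ⟨H, ⟨F, hF, hTF, hFH, hyH⟩, hmax⟩ :=
      (wellFounded_gt (α := Submodule (ZMod 2) V)).has_min
        {W | ∃ F ⊆ M₁.E, T ⊆ F ∧ span (ZMod 2) (φ '' F) = W ∧ y ∉ W}
        ⟨_, T, inter_subset_left, Subset.rfl, rfl, fun h' => hyT (hTspan y h' hy0)⟩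
    set F₁ := {e | e ∈ M₁.E ∧ φ e ∈ H} with hF₁
    have hFF₁ : F ⊆ F₁ := fun e he => ⟨hF he, hFH ▸ subset_span (mem_image_of_mem φ he)⟩
    have hX : M.IsFlat (F₁ ∪ M₂.E) := by
      rw [hM.isFlat_iff _ (union_subset_union_left _ fun e he => he.1)]
      have h1 : (F₁ ∪ M₂.E) ∩ M₁.E = F₁ := by
        ext e
        constructor
        · rintro ⟨he | he, he'⟩
          · exact he
          · exact hFF₁ (hTF ⟨he', he⟩)
        · exact fun he => ⟨Or.inl he, he.1⟩
      rw [h1, inter_eq_right.2 subset_union_right]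
      exact ⟨hrep₁.isFlat_preimage H, M₂.ground_isFlat⟩
    have hall : M₁.E ⊆ F₁ := by
      intro e he
      by_contra heF
      have hlt : H < span (ZMod 2) (φ '' insert e F₁) := by
        refine lt_of_le_of_ne (hFH ▸ span_mono (image_mono (hFF₁.trans (subset_insert _ _))))
          fun h' => heF ⟨he, ?_⟩
        rw [h']
        exact subset_span (mem_image_of_mem φ (mem_insert _ _))
      have hyin : y ∈ span (ZMod 2) (φ '' insert e F₁) := by
        by_contra hy'
        exact hmax _ ⟨insert e F₁, insert_subset he fun f hf => hf.1,
          (hTF.trans hFF₁).trans (subset_insert _ _), rfl, hy'⟩ hlt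
      rw [image_insert_eq, mem_span_insert] at hyin
      obtain ⟨c, z, hz, hyz⟩ := hyin
      have hzH : z ∈ H := span_le.2 (by rintro _ ⟨f, hf, rfl⟩; exact hf.2) hz
      rcases zmod_two_eq c with rfl | rfl
      · rw [zero_smul, zero_add] at hyz
        exact hyH (hyz ▸ hzH)
      · rw [one_smul] at hyz
        have hez : φ e = y - z := by rw [hyz, add_sub_cancel_right]
        have hes : φ e ∈ span (ZMod 2) (φ '' (F₁ ∪ M₂.E)) := by
          rw [hez]
          exact sub_mem (span_mono (image_mono subset_union_right) hy₂)
            (span_mono (image_mono subset_union_left) hz)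
        rcases (h.isFlat_iff.1 hX).2 e (hE₁ he) hes with h' | h'
        · exact heF h'
        · exact heF (hFF₁ (hTF ⟨he, h'⟩))
    refine hyH (span_le.2 ?_ hy₁)
    rintro _ ⟨e, he, rfl⟩
    exact (hall he).2

theorem VChordal.isFieldChordal [Module.Finite (ZMod 2) V] {E : Set V} (hE : VChordal E) :
    ∀ {M : Matroid α}, Rep M φ → M.IsSimpleMatroid → φ '' M.E = E →
      M.IsFieldChordal (ZMod 2) := by
  induction hE with
  | pg U =>
    intro M h hs hE
    exact .projectiveGeometry M (h.isProjectiveGeometry (h.simple_iff.1 hs).1 hE)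
  | glue E₁ E₂ hv₁ hv₂ hg IH₁ IH₂ =>
    intro M h hs hE
    obtain ⟨hi, h0⟩ := h.simple_iff.1 hs
    have hne := (VChordal.glue _ _ hv₁ hv₂ hg).ne_zero
    set F₁ := {e | e ∈ M.E ∧ φ e ∈ E₁} with hF₁
    set F₂ := {e | e ∈ M.E ∧ φ e ∈ E₂} with hF₂
    have hF₁E : F₁ ⊆ M.E := fun e he => he.1
    have hF₂E : F₂ ⊆ M.E := fun e he => he.1
    have himg : ∀ S ⊆ E₁ ∪ E₂, φ '' {e | e ∈ M.E ∧ φ e ∈ S} = S := by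
      intro S hS
      ext x
      constructor
      · rintro ⟨e, he, rfl⟩; exact he.2
      · intro hx
        obtain ⟨e, he, rfl⟩ := hE.superset (hS hx)
        exact ⟨e, ⟨he, hx⟩, rfl⟩
    have him₁ : φ '' F₁ = E₁ := himg _ subset_union_left
    have him₂ : φ '' F₂ = E₂ := himg _ subset_union_right
    have hr₁ := h.restrict hF₁E
    have hr₂ := h.restrict hF₂E
    have hs₁ := Rep.simple_restrict hs hF₁E
    have hs₂ := Rep.simple_restrict hs hF₂E
    have hTeq : φ '' (F₁ ∩ F₂) = {x | x ∈ span (ZMod 2) E₁ ⊓ span (ZMod 2) E₂ ∧ x ≠ 0} := by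
      ext x
      constructor
      · rintro ⟨e, he, rfl⟩
        exact ⟨⟨subset_span he.1.2, subset_span he.2.2⟩, h0 e he.1.1⟩
      · rintro ⟨⟨hx₁, hx₂⟩, hx0⟩
        obtain ⟨h1, h2⟩ := hg x hx₁ hx₂ hx0
        obtain ⟨e, he, rfl⟩ := hE.superset (Or.inl h1)
        exact ⟨e, ⟨⟨he, h1⟩, he, h2⟩, rfl⟩
    have hTE : F₁ ∩ F₂ ⊆ M.E := fun e he => he.1.1
    have hTspan : span (ZMod 2) (φ '' (F₁ ∩ F₂)) = span (ZMod 2) E₁ ⊓ span (ZMod 2) E₂ := by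
      refine le_antisymm (span_le.2 fun x hx => (hTeq.subset hx).1) fun x hx => ?_
      by_cases hx0 : x = 0
      · exact hx0 ▸ zero_mem _
      · exact subset_span (hTeq.superset ⟨hx, hx0⟩)
    have hTmem : ∀ x ∈ span (ZMod 2) E₁, x ∈ span (ZMod 2) E₂ → x ≠ 0 → ∃ t ∈ F₁ ∩ F₂, φ t = x :=
      fun x h1 h2 h3 => hTeq.superset ⟨⟨h1, h2⟩, h3⟩
    have hrT := h.restrict hTE
    have hN : (M ↾ (F₁ ∩ F₂)).IsProjectiveGeometry (ZMod 2) :=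
      hrT.isProjectiveGeometry (hi.mono hTE) hTeq
    refine .generalizedParallelConnection M (M ↾ F₁) (M ↾ F₂) (M ↾ (F₁ ∩ F₂))
      (IH₁ hr₁ hs₁ him₁) (IH₂ hr₂ hs₂ him₂) hN ⟨⟨?_, ?_⟩, ?_, ?_, ?_, ?_⟩
    · refine hr₁.isFlat_iff.2 ⟨inter_subset_left, fun e he hes => ?_⟩
      simp only [Matroid.restrict_ground_eq] at hes he ⊢
      rw [hTspan] at hes
      obtain ⟨t, ht, hte⟩ := hTmem _ hes.1 hes.2 (h0 e he.1)
      rwa [← hi ht.1.1 he.1 hte]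
    · intro G hG
      simp only [Matroid.restrict_ground_eq]
      have hGF := hG.subset_ground
      have hflat := (hr₁.isFlat_iff.1 hG).2
      simp only [Matroid.restrict_ground_eq] at hGF hflat
      rw [hr₁.eRk_eq (inter_subset_left : F₁ ∩ F₂ ⊆ F₁), hr₁.eRk_eq hGF,
        hr₁.eRk_eq (union_subset inter_subset_left hGF : F₁ ∩ F₂ ∪ G ⊆ F₁),
        hr₁.eRk_eq ((inter_subset_left.trans inter_subset_left : F₁ ∩ F₂ ∩ G ⊆ F₁)),
        image_union, span_union]
      have hinf : span (ZMod 2) (φ '' (F₁ ∩ F₂ ∩ G)) =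
          span (ZMod 2) (φ '' (F₁ ∩ F₂)) ⊓ span (ZMod 2) (φ '' G) := by
        refine le_antisymm (le_inf (span_mono (image_mono inter_subset_left))
          (span_mono (image_mono inter_subset_right))) ?_
        rintro x ⟨hxT, hxG⟩
        by_cases hx0 : x = 0
        · exact hx0 ▸ zero_mem _
        · rw [hTspan] at hxT
          obtain ⟨t, ht, rfl⟩ := hTmem x hxT.1 hxT.2 hx0
          exact subset_span ⟨t, ⟨ht, hflat t ht.1 hxG⟩, rfl⟩
      rw [hinf]
      exact_mod_cast (finrank_sup_add_finrank_inf_eq _ _).symm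
    · simp only [Matroid.restrict_ground_eq]
      rw [Matroid.restrict_restrict_eq _ inter_subset_left]
    · simp only [Matroid.restrict_ground_eq]
      rw [Matroid.restrict_restrict_eq _ inter_subset_right]
    · simp only [Matroid.restrict_ground_eq]
      ext e
      constructor
      · intro he
        exact (hE.subset (mem_image_of_mem φ he)).imp (⟨he, ·⟩) (⟨he, ·⟩)
      · rintro (he | he) <;> exact he.1
    · intro X hX
      simp only [Matroid.restrict_ground_eq] at hX ⊢
      rw [h.isFlat_iff, hr₁.isFlat_iff, hr₂.isFlat_iff]
      simp only [Matroid.restrict_ground_eq]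
      constructor
      · rintro ⟨hXE, hfl⟩
        exact ⟨⟨inter_subset_right, fun e he hes =>
            ⟨hfl e he.1 (span_mono (image_mono inter_subset_left) hes), he⟩⟩,
          ⟨inter_subset_right, fun e he hes =>
            ⟨hfl e he.1 (span_mono (image_mono inter_subset_left) hes), he⟩⟩⟩
      · rintro ⟨⟨_, hfl₁⟩, _, hfl₂⟩
        refine ⟨hX.trans (union_subset hF₁E hF₂E), fun e he hes => ?_⟩
        -- If `e` is on the first side, `b` lies in both spans, so it is zero or comes from a common
        -- element; flatness of `X ∩ F₂` puts that element in `X`. The other side is symmetric.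
        obtain ⟨a, ha, b, hb, hab⟩ := exists_add_of_mem_span (A := φ '' (X ∩ F₁))
          (B := φ '' (X ∩ F₂)) (by
            rintro _ ⟨x, hx, rfl⟩
            exact (hX hx).imp (fun h => ⟨x, ⟨hx, h⟩, rfl⟩) (fun h => ⟨x, ⟨hx, h⟩, rfl⟩)) hes
        have ha₁ : a ∈ span (ZMod 2) E₁ :=
          span_mono (by rintro _ ⟨x, hx, rfl⟩; exact hx.2.2) ha
        have hb₂ : b ∈ span (ZMod 2) E₂ :=
          span_mono (by rintro _ ⟨x, hx, rfl⟩; exact hx.2.2) hb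
        rcases hE.subset (mem_image_of_mem φ he) with heE | heE
        · have hb₁ : b ∈ span (ZMod 2) E₁ :=
            (Submodule.add_mem_iff_right _ ha₁).1 (hab ▸ subset_span heE)
          refine (hfl₁ e ⟨he, heE⟩ ?_).1
          rw [← hab]
          refine add_mem ha ?_
          by_cases hb0 : b = 0
          · exact hb0 ▸ zero_mem _
          · obtain ⟨t, ht, rfl⟩ := hTmem b hb₁ hb₂ hb0
            exact subset_span ⟨t, ⟨(hfl₂ t ht.2 hb).1, ht.1⟩, rfl⟩
        · have ha₂ : a ∈ span (ZMod 2) E₂ :=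
            (Submodule.add_mem_iff_left _ hb₂).1 (hab ▸ subset_span heE)
          refine (hfl₂ e ⟨he, heE⟩ ?_).1
          rw [← hab]
          refine add_mem ?_ hb
          by_cases ha0 : a = 0
          · exact ha0 ▸ zero_mem _
          · obtain ⟨t, ht, rfl⟩ := hTmem a ha₁ ha₂ ha0
            exact subset_span ⟨t, ⟨(hfl₁ t ht.1 ha).1, ht.2⟩, rfl⟩

end BinaryChordal

/-! ### Contraction and simplification of represented matroids. -/

namespace BinaryChordal

open Submodule Module Set
open scoped Matroid

variable {α : Type*} {V : Type*} [AddCommGroup V] [Module (ZMod 2) V] {M N : Matroid α} {φ : α → V}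

lemma Rep.contract (h : Rep M φ) {C : Set α} (hC : C ⊆ M.E) :
    Rep (M ／ C) (mkQ (span (ZMod 2) (φ '' C)) ∘ φ) := by
  intro I hI
  obtain ⟨J, hJ⟩ := M.exists_isBasis C
  rw [Matroid.contract_ground, subset_sdiff] at hI
  have hi : LinearIndepOn (ZMod 2) φ J := (h J hJ.indep.subset_ground).1 hJ.indep
  rw [hJ.contract_indep_iff, and_iff_left hI.2.symm, ← h.span_basis hJ,
    hi.quotient_iff_union (hI.2.symm.mono_left hJ.subset), union_comm,
    h _ (union_subset hJ.indep.subset_ground hI.1)]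

lemma Rep.isNonloop_iff (h : Rep M φ) {e : α} : M.IsNonloop e ↔ e ∈ M.E ∧ φ e ≠ 0 := by
  constructor
  · intro he
    refine ⟨he.mem_ground, ?_⟩
    have := (h _ (singleton_subset_iff.2 he.mem_ground)).1 (Matroid.indep_singleton.2 he)
    rwa [linearIndepOn_singleton_iff] at this
  · rintro ⟨he, h0⟩
    rw [← Matroid.indep_singleton, h _ (singleton_subset_iff.2 he), linearIndepOn_singleton_iff]
    exact h0

lemma Rep.closure_singleton_eq_iff (h : Rep M φ) {e f : α} (he : M.IsNonloop e)
    (hf : M.IsNonloop f) : M.closure {f} = M.closure {e} ↔ φ f = φ e := by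
  have heE := he.mem_ground
  have hfE := hf.mem_ground
  constructor
  · intro hcl
    have : f ∈ M.closure {e} := hcl ▸ M.mem_closure_of_mem rfl (singleton_subset_iff.2 hfE)
    rw [h.mem_closure_iff (singleton_subset_iff.2 heE) hfE, image_singleton,
      mem_span_singleton_iff] at this
    exact this.resolve_left (h.isNonloop_iff.1 hf).2
  · intro hef
    ext g
    by_cases hg : g ∈ M.E
    · rw [h.mem_closure_iff (singleton_subset_iff.2 heE) hg,
        h.mem_closure_iff (singleton_subset_iff.2 hfE) hg, image_singleton, image_singleton, hef]
    · exact iff_of_false (fun h' => hg (Matroid.mem_ground_of_mem_closure h'))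
        fun h' => hg (Matroid.mem_ground_of_mem_closure h')

lemma Rep.of_isSimplificationOf (h : Rep M φ) (hN : N.IsSimplificationOf M) :
    Rep N φ ∧ N.IsSimpleMatroid ∧ N.E ⊆ M.E ∧ φ '' N.E = {y | y ∈ φ '' M.E ∧ y ≠ 0} := by
  obtain ⟨X, hX, hX', rfl⟩ := hN
  have hXE : X ⊆ M.E := fun e he => (hX e he).mem_ground
  have hr := h.restrict hXE
  refine ⟨hr, hr.simple_iff.2 ⟨fun e he f hf hef => ?_, fun e he => (h.isNonloop_iff.1 (hX e he)).2⟩,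
    hXE, ?_⟩
  · exact (hX' f (hX f hf)).unique
      ⟨he, (h.closure_singleton_eq_iff (hX f hf) (hX e he)).2 hef⟩ ⟨hf, rfl⟩
  · ext y
    constructor
    · rintro ⟨e, he, rfl⟩
      exact ⟨⟨e, hXE he, rfl⟩, (h.isNonloop_iff.1 (hX e he)).2⟩
    · rintro ⟨⟨e, he, rfl⟩, h0⟩
      have hen := h.isNonloop_iff.2 ⟨he, h0⟩
      obtain ⟨f, ⟨hf, hfe⟩, -⟩ := hX' e hen
      exact ⟨f, hf, (h.closure_singleton_eq_iff hen (hX f hf)).1 hfe⟩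

lemma Rep.exists_isSimplificationOf (h : Rep M φ) : ∃ N : Matroid α, N.IsSimplificationOf M := by
  obtain ⟨X, hX, hbij⟩ := exists_subset_bijOn {e | M.IsNonloop e} φ
  refine ⟨M ↾ X, X, fun e he => hX he, fun e he => ?_, rfl⟩
  obtain ⟨f, hf, hfe⟩ := hbij.surjOn (mem_image_of_mem φ he)
  refine ⟨f, ⟨hf, (h.closure_singleton_eq_iff he (hX hf)).2 hfe⟩, fun g ⟨hg, hge⟩ => ?_⟩
  exact hbij.injOn hg hf (((h.closure_singleton_eq_iff he (hX hg)).1 hge).trans hfe.symm)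

lemma Rep.eq_of_isSimplificationOf (h : Rep M φ) (hs : M.IsSimpleMatroid)
    (hN : N.IsSimplificationOf M) : N = M := by
  obtain ⟨hi, h0⟩ := h.simple_iff.1 hs
  obtain ⟨-, -, hNE, himg⟩ := h.of_isSimplificationOf hN
  obtain ⟨X, hX, hX', rfl⟩ := hN
  have hXE : X = M.E := by
    refine Subset.antisymm hNE fun e he => ?_
    obtain ⟨f, hf, hfe⟩ := himg.superset ⟨mem_image_of_mem φ he, h0 e he⟩
    rwa [← hi (hNE hf) he hfe]
  rw [hXE, Matroid.restrict_ground_eq_self]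

lemma finrank_map_mkQ_lt [Module.Finite (ZMod 2) V] {S W : Submodule (ZMod 2) V} {c : V}
    (hcS : c ∈ S) (hcW : c ∈ W) (hc : c ≠ 0) :
    finrank (ZMod 2) (W.map S.mkQ) < finrank (ZMod 2) W := by
  have h1 := LinearMap.finrank_range_add_finrank_ker (S.mkQ.domRestrict W)
  rw [LinearMap.range_domRestrict] at h1
  have h2 : 0 < finrank (ZMod 2) (LinearMap.ker (S.mkQ.domRestrict W)) := by
    rw [finrank_pos_iff_exists_ne_zero]
    refine ⟨⟨⟨c, hcW⟩, ?_⟩, fun h' => hc ?_⟩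
    · simpa using hcS
    · simpa [Subtype.ext_iff] using h'
  omega

lemma Rep.finrank_contract_lt [Module.Finite (ZMod 2) V] (h : Rep M φ) (hs : M.IsSimpleMatroid)
    {C : Set α} (hC : C ⊆ M.E) (hne : C.Nonempty) {A : Set α} (hA : A ⊆ M.E) :
    finrank (ZMod 2) (span (ZMod 2) ((mkQ (span (ZMod 2) (φ '' C)) ∘ φ) '' A)) <
      finrank (ZMod 2) (span (ZMod 2) (φ '' M.E)) := by
  obtain ⟨c, hc⟩ := hne
  refine lt_of_le_of_lt ?_ (finrank_map_mkQ_lt (subset_span (mem_image_of_mem φ hc))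
    (subset_span (mem_image_of_mem φ (hC hc))) ((h.simple_iff.1 hs).2 c (hC hc)))
  rw [map_span, ← image_comp]
  exact Submodule.finrank_mono (span_mono (image_mono hA))

lemma Rep.restrict_isFlat_eq_or_lt [Module.Finite (ZMod 2) V] (h : Rep M φ) {F : Set α}
    (hF : M.IsFlat F) : M ↾ F = M ∨
      finrank (ZMod 2) (span (ZMod 2) (φ '' F)) < finrank (ZMod 2) (span (ZMod 2) (φ '' M.E)) := by
  by_cases hFE : F = M.E
  · exact Or.inl (by rw [hFE, Matroid.restrict_ground_eq_self])
  · refine Or.inr (Submodule.finrank_lt_finrank_of_lt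
      (lt_of_le_of_ne (span_mono (image_mono hF.subset_ground)) fun heq => hFE ?_))
    refine Subset.antisymm hF.subset_ground fun e he => (h.isFlat_iff.1 hF).2 e he ?_
    rw [heq]
    exact subset_span (mem_image_of_mem φ he)

end BinaryChordal

/-! ### Induced minors, and forbidden ones in terms of vectors. -/

namespace BinaryChordal

open Submodule Module Set
open scoped Matroid

universe u v

variable {α : Type u} {V : Type v} [AddCommGroup V] [Module (ZMod 2) V] [Module.Finite (ZMod 2) V]
  {M : Matroid α} {φ : α → V}

/-- A proper induced minor of a simple binary matroid is simple, binary and of smaller rank. -/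
theorem Rep.eq_or_exists_of_hasInducedMinor (h : Rep M φ) (hs : M.IsSimpleMatroid) {N : Matroid α}
    (hN : M.HasInducedMinor N) : N = M ∨ ∃ (W : Type v) (_ : AddCommGroup W)
      (_ : Module (ZMod 2) W) (_ : Module.Finite (ZMod 2) W) (ψ : α → W), Rep N ψ ∧
      N.IsSimpleMatroid ∧ finrank (ZMod 2) (span (ZMod 2) (ψ '' N.E)) <
        finrank (ZMod 2) (span (ZMod 2) (φ '' M.E)) := by
  induction hN with
  | refl => exact Or.inl rfl
  | restrict_flat N F hN hF IH =>
    rcases IH with rfl | ⟨W, _, _, _, ψ, hr, hsN, hlt⟩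
    · refine (h.restrict_isFlat_eq_or_lt hF).imp id fun hlt => ?_
      exact ⟨V, _, _, inferInstance, φ, h.restrict hF.subset_ground,
        Rep.simple_restrict hs hF.subset_ground, hlt⟩
    · refine Or.inr ⟨W, _, _, inferInstance, ψ, hr.restrict hF.subset_ground,
        Rep.simple_restrict hsN hF.subset_ground, lt_of_le_of_lt ?_ hlt⟩
      exact Submodule.finrank_mono (span_mono (image_mono hF.subset_ground))
  | contract N N' C hN hC hN' IH =>
    -- Contracting nothing does not lower the rank, but a simple matroid is its own only
    -- simplification.
    rcases C.eq_empty_or_nonempty with rfl | hne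
    · rw [Matroid.contract_empty] at hN'
      rcases IH with rfl | ⟨W, _, _, _, ψ, hr, hsN, hlt⟩
      · exact Or.inl (h.eq_of_isSimplificationOf hs hN')
      · obtain rfl := hr.eq_of_isSimplificationOf hsN hN'
        exact Or.inr ⟨W, _, _, inferInstance, ψ, hr, hsN, hlt⟩
    · rcases IH with rfl | ⟨W, _, _, _, ψ, hr, hsN, hlt⟩
      · obtain ⟨h1, h2, h3, -⟩ := (h.contract hC).of_isSimplificationOf hN'
        exact Or.inr ⟨_, _, _, inferInstance, _, h1, h2,
          h.finrank_contract_lt hs hC hne (h3.trans sdiff_subset)⟩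
      · obtain ⟨h1, h2, h3, -⟩ := (hr.contract hC).of_isSimplificationOf hN'
        exact Or.inr ⟨_, _, _, inferInstance, _, h1, h2,
          (hr.finrank_contract_lt hsN hC hne (h3.trans sdiff_subset)).trans hlt⟩

theorem Rep.isForbiddenInducedMinor {n : ℕ} {φ : α → Fin n → ZMod 2} (h : Rep M φ)
    (hs : M.IsSimpleMatroid) (hr : finrank (ZMod 2) (span (ZMod 2) (φ '' M.E)) ≤ 3)
    (hv : ¬ VChordal (φ '' M.E)) : M.IsForbiddenInducedMinor (ZMod 2) where
  finite := by
    refine ⟨Finite.of_finite_image (f := φ) (toFinite _) (h.simple_iff.1 hs).1⟩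
  simple := hs
  representable := ⟨n, φ, h⟩
  not_chordal hc := hv (h.vchordal hc hs)
  chordal_of_proper N hN hne := by
    obtain ⟨W, _, _, _, ψ, hrN, hsN, hlt⟩ :=
      (h.eq_or_exists_of_hasInducedMinor hs hN).resolve_left hne
    refine VChordal.isFieldChordal (vchordal_of_finrank_le ?_ (by omega)) hrN hsN rfl
    rintro ⟨e, he, h0⟩
    exact (hrN.simple_iff.1 hsN).2 e he h0

theorem minNonchordal_of_isForbiddenInducedMinor (hM : M.IsForbiddenInducedMinor (ZMod 2))
    (h : Rep M φ) : MinNonchordal (φ '' M.E) := by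
  have hs := hM.simple
  obtain ⟨hi, h0⟩ := h.simple_iff.1 hs
  refine ⟨?_, ?_, ?_, fun hv => hM.not_chordal (hv.isFieldChordal h hs rfl)⟩
  · rintro ⟨e, he, he0⟩
    exact h0 e he he0
  · rintro U ⟨_, ⟨e, he, rfl⟩, heU⟩
    have hF := h.isFlat_preimage U
    have hne : M ↾ {e | e ∈ M.E ∧ φ e ∈ U} ≠ M := fun heq => heU
      ((congrArg Matroid.E heq).superset he).2
    have hc := hM.chordal_of_proper _ (.restrict_flat M _ .refl hF) hne
    have := (h.restrict hF.subset_ground).vchordal hc (Rep.simple_restrict hs hF.subset_ground)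
    convert this using 1
    ext x
    constructor
    · rintro ⟨⟨e, he, rfl⟩, hx⟩
      exact ⟨e, ⟨he, hx⟩, rfl⟩
    · rintro ⟨e, he, rfl⟩
      exact ⟨⟨e, he.1, rfl⟩, he.2⟩
  · rintro U _ ⟨m, hm, rfl⟩ hmU
    have hF := h.isFlat_preimage U
    set F := {e | e ∈ M.E ∧ φ e ∈ U}
    have hr := h.restrict hF.subset_ground
    have hmF : m ∈ F := ⟨hm, hmU⟩
    have hC : {m} ⊆ (M ↾ F).E := singleton_subset_iff.2 hmF
    have hrc := hr.contract hC
    obtain ⟨N, hN⟩ := hrc.exists_isSimplificationOf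
    obtain ⟨h1, h2, h3, h4⟩ := hrc.of_isSimplificationOf hN
    have hne : N ≠ M := by
      rintro rfl
      exact (h3 hm).2 rfl
    have hc := hM.chordal_of_proper _
      (.contract (M ↾ F) N {m} (.restrict_flat M F .refl hF) hC hN) hne
    have := h1.vchordal hc h2
    rw [h4, image_singleton] at this
    convert this using 1
    ext y
    constructor
    · rintro ⟨hy0, _, ⟨e, he, rfl⟩, heU, rfl⟩
      refine ⟨⟨e, ⟨⟨he, heU⟩, ?_⟩, rfl⟩, hy0⟩
      rintro rfl
      exact hy0 (by simp)
    · rintro ⟨⟨e, he, rfl⟩, hy0⟩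
      exact ⟨hy0, φ e, ⟨e, he.1.1, rfl⟩, he.1.2, rfl⟩

/-- The bad section is a flat; were it proper, it would be chordal by minimality. -/
theorem Rep.isFourCircuit_or_isFanoMinusPoint (hM : M.IsForbiddenInducedMinor (ZMod 2))
    (h : Rep M φ) : IsFourCircuit (φ '' M.E) ∨ IsFanoMinusPoint (φ '' M.E) := by
  have hmin := minNonchordal_of_isForbiddenInducedMinor hM h
  obtain ⟨U, hU⟩ := hmin.hasBadPlane
  have hall : {x | x ∈ φ '' M.E ∧ x ∈ U} = φ '' M.E := by
    refine Subset.antisymm (fun x hx => hx.1) fun x hx => ⟨hx, ?_⟩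
    by_contra hxU
    exact hU.elim (fun h' => h'.not_vchordal (hmin.flat U ⟨x, hx, hxU⟩))
      fun h' => h'.not_vchordal (hmin.flat U ⟨x, hx, hxU⟩)
  rwa [hall] at hU

end BinaryChordal

/-! ### Cycle matroids over GF(2), and recognition of M(K_4) and U_{3,4}. -/

namespace BinaryChordal

open Submodule Module Set

section Graph

variable {ι V : Type*} [AddCommGroup V]

/-- The vector of an edge, for an assignment of vectors to the vertices of a graph. -/
def edgeVector (g : ι → V) : Sym2 ι → V :=
  Sym2.lift ⟨fun i j => g i + g j, fun i j => add_comm (g i) (g j)⟩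

@[simp] lemma edgeVector_mk (g : ι → V) (i j : ι) : edgeVector g s(i, j) = g i + g j := rfl

lemma edgeVector_image_top (x y z : V) :
    edgeVector ![0, x, y, z] '' (⊤ : SimpleGraph (Fin 4)).edgeSet =
      {x, y, x + y, y + z, x + z, z} := by
  ext v
  simp only [mem_image, Sym2.exists, SimpleGraph.mem_edgeSet, SimpleGraph.top_adj,
    Fin.exists_fin_succ, edgeVector_mk, mem_insert_iff, mem_singleton_iff]
  simp [add_comm y x, add_comm z x, add_comm z y, eq_comm (a := v)]
  tauto

variable [Module (ZMod 2) V] {g : ι → V}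

/-- The differences of the vectors `g i` satisfy no relations beyond the obvious ones. -/
def AffinelyFree (g : ι → V) : Prop :=
  ∀ c : ι → ZMod 2, ∃ f : V →ₗ[ZMod 2] ZMod 2, ∀ i j, f (g i + g j) = c i + c j

lemma reachable_fromEdgeSet_iff (hg : AffinelyFree g) (T : Set (Sym2 ι)) (u v : ι) :
    (SimpleGraph.fromEdgeSet T).Reachable u v ↔
      g u + g v ∈ span (ZMod 2) (edgeVector g '' T) := by
  classical
  constructor
  · rintro ⟨p⟩
    induction p with
    | nil => exact add_self_eq_zero' (g _) ▸ zero_mem _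
    | @cons u w v huw p ih =>
      have h1 : g u + g w ∈ span (ZMod 2) (edgeVector g '' T) :=
        subset_span ⟨s(u, w), (SimpleGraph.fromEdgeSet_adj T).1 huw |>.1, rfl⟩
      have := add_mem h1 ih
      rwa [add_assoc, add_add_cancel_self] at this
  · intro h
    by_contra huv
    -- The cut around the component of `u`: a functional that vanishes on the edges in `T` but not
    -- on `g u + g v`.
    obtain ⟨f, hf⟩ := hg fun i => if (SimpleGraph.fromEdgeSet T).Reachable u i then 1 else 0
    have hle : span (ZMod 2) (edgeVector g '' T) ≤ LinearMap.ker f := by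
      refine span_le.2 ?_
      rintro _ ⟨e, he, rfl⟩
      induction e with
      | h i j =>
        rw [SetLike.mem_coe, LinearMap.mem_ker, edgeVector_mk, hf]
        by_cases hij : i = j
        · rw [hij]
          exact add_self_eq_zero' _
        · have hadj : (SimpleGraph.fromEdgeSet T).Adj i j :=
            (SimpleGraph.fromEdgeSet_adj T).2 ⟨he, hij⟩
          have : (SimpleGraph.fromEdgeSet T).Reachable u i ↔
              (SimpleGraph.fromEdgeSet T).Reachable u j :=
            ⟨fun h => h.trans hadj.reachable, fun h => h.trans hadj.symm.reachable⟩
          rw [if_congr this rfl rfl]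
          exact add_self_eq_zero' _
    have h0 := hle h
    rw [LinearMap.mem_ker, hf, if_pos SimpleGraph.Reachable.rfl, if_neg huv] at h0
    exact absurd h0 (by decide)

/-- A graph is acyclic when each edge is a bridge, and an edge is a bridge when its vector is
outside the span of the other edge vectors. -/
lemma isAcyclic_fromEdgeSet_iff (hg : AffinelyFree g) {S : Set (Sym2 ι)}
    (hS : ∀ e ∈ S, ¬ e.IsDiag) :
    (SimpleGraph.fromEdgeSet S).IsAcyclic ↔ LinearIndepOn (ZMod 2) (edgeVector g) S := by
  rw [SimpleGraph.isAcyclic_iff_forall_isBridge, linearIndepOn_iff_notMem_span]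
  have hE : (SimpleGraph.fromEdgeSet S).edgeSet = S := by
    rw [SimpleGraph.edgeSet_fromEdgeSet, sdiff_eq_left, Set.disjoint_left]
    exact hS
  rw [hE]
  refine forall₂_congr fun e he => ?_
  induction e with
  | h i j =>
    rw [SimpleGraph.isBridge_iff, SimpleGraph.deleteEdges_fromEdgeSet,
      reachable_fromEdgeSet_iff hg, edgeVector_mk]

lemma AffinelyFree.injOn_edgeVector (hg : AffinelyFree g) :
    InjOn (edgeVector g) {e | ¬ e.IsDiag} := by
  classical
  have key : ∀ i j : ι, i ≠ j → ∀ e, edgeVector g s(i, j) = edgeVector g e → i ∈ e := by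
    intro i j hij e
    induction e with
    | h k l =>
      intro h
      -- This functional detects the edges at the vertex `i`.
      obtain ⟨f, hf⟩ := hg (Pi.single i 1)
      have h1 := hf i j
      have h2 := hf k l
      rw [edgeVector_mk, edgeVector_mk] at h
      rw [h, h2, Pi.single_eq_same, Pi.single_eq_of_ne hij.symm] at h1
      by_contra hi
      rw [Sym2.mem_iff, not_or] at hi
      rw [Pi.single_eq_of_ne (Ne.symm hi.1), Pi.single_eq_of_ne (Ne.symm hi.2)] at h1
      exact absurd h1 (by decide)
  intro d hd e _ hde
  induction d with
  | h i j =>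
    have hij : i ≠ j := hd
    exact ((Sym2.mem_and_mem_iff hij).1 ⟨key i j hij e hde,
      key j i hij.symm e (by rw [Sym2.eq_swap, hde])⟩).symm

lemma affinelyFree_of_linearIndependent {x y z : V} (h : LinearIndependent (ZMod 2) ![x, y, z]) :
    AffinelyFree ![0, x, y, z] := by
  intro c
  obtain ⟨f, hf⟩ := LinearMap.exists_extend ((Basis.span h).constr (ZMod 2)
    fun i => c i.succ + c 0)
  have hfi : ∀ i, f (![x, y, z] i) = c i.succ + c 0 := by
    intro i
    have h1 := LinearMap.congr_fun hf (Basis.span h i)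
    rw [Basis.constr_basis] at h1
    rw [← h1, LinearMap.comp_apply, subtype_apply, Basis.span_apply]
  have hall : ∀ i, f (![0, x, y, z] i) = c i + c 0 := by
    intro i
    refine Fin.cases ?_ (fun i => ?_) i
    · rw [add_self_eq_zero' (c 0)]
      exact map_zero f
    · exact hfi i
  refine ⟨f, fun i j => ?_⟩
  rw [map_add, hall, hall, add_add_add_comm, add_self_eq_zero' (c 0), add_zero]

end Graph

section Recognition

variable {α V : Type*} [AddCommGroup V] [Module (ZMod 2) V] {M : Matroid α} {φ : α → V}

lemma IsFanoMinusPoint.eq_edgeVector_image {E : Set V} (h : IsFanoMinusPoint E) :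
    ∃ x y z : V, LinearIndependent (ZMod 2) ![x, y, z] ∧
      E = edgeVector ![0, x, y, z] '' (⊤ : SimpleGraph (Fin 4)).edgeSet := by
  obtain ⟨a, b, p, hi, rfl⟩ := h
  obtain ⟨ha, hb, hp, hab, hap, hbp, habp⟩ := linearIndependent_triple_iff.1 hi
  have h1 : b + (a + b + p) = a + p := by
    rw [add_comm a b, add_assoc, add_add_cancel_self]
  have h2 : a + (a + b + p) = b + p := by
    rw [add_assoc, add_add_cancel_self]
  -- The missing point must be the sum of the three nonzero vertex vectors, the only nonzero vector
  -- of their span that is not an edge vector of `K₄`; hence the third is `a + b + p`.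
  refine ⟨a, b, a + b + p, linearIndependent_triple_iff.2 ⟨ha, hb, habp, hab, ?_, ?_, ?_⟩, ?_⟩
  · rwa [h2]
  · rwa [h1]
  · rwa [add_add_cancel_self]
  · rw [edgeVector_image_top, h1, h2]

lemma isFanoMinusPoint_edgeVector_image {x y z : V}
    (h : LinearIndependent (ZMod 2) ![x, y, z]) :
    IsFanoMinusPoint (edgeVector ![0, x, y, z] '' (⊤ : SimpleGraph (Fin 4)).edgeSet) := by
  obtain ⟨hx, hy, hz, hxy, hxz, hyz, hxyz⟩ := linearIndependent_triple_iff.1 h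
  have h1 : x + (x + y + z) = y + z := by
    rw [add_assoc, add_add_cancel_self]
  have h2 : y + (x + y + z) = x + z := by
    rw [add_comm x y, add_assoc, add_add_cancel_self]
  have h3 : x + y + (x + y + z) = z := add_add_cancel_self _ _
  refine ⟨x, y, x + y + z, linearIndependent_triple_iff.2 ⟨hx, hy, hxyz, hxy, ?_, ?_, ?_⟩, ?_⟩
  · rwa [h1]
  · rwa [h2]
  · rwa [h3]
  · rw [edgeVector_image_top, h1, h2, h3]

lemma rep_iff_isAcyclic {ι : Type*} {g : ι → V} (hg : AffinelyFree g) {G : SimpleGraph ι}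
    (e : M.E ≃ G.edgeSet) (he : ∀ m : M.E, φ m = edgeVector g (e m)) :
    Rep M φ ↔ ∀ I : Set M.E, M.Indep (Subtype.val '' I) ↔
      (SimpleGraph.fromEdgeSet ((fun x : M.E => (e x : Sym2 ι)) '' I)).IsAcyclic := by
  have key : ∀ I : Set M.E, LinearIndepOn (ZMod 2) φ (Subtype.val '' I) ↔
      (SimpleGraph.fromEdgeSet ((fun x : M.E => (e x : Sym2 ι)) '' I)).IsAcyclic := by
    intro I
    rw [isAcyclic_fromEdgeSet_iff hg
      (by rintro _ ⟨m, _, rfl⟩; exact G.not_isDiag_of_mem_edgeSet (e m).2)]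
    have h1 : LinearIndepOn (ZMod 2) (φ ∘ Subtype.val) I ↔
        LinearIndepOn (ZMod 2) φ (Subtype.val '' I) :=
      linearIndependent_equiv' (Equiv.Set.imageOfInjOn _ _ Subtype.val_injective.injOn) rfl
    have h2 : LinearIndepOn (ZMod 2) (edgeVector g ∘ fun x : M.E => (e x : Sym2 ι)) I ↔
        LinearIndepOn (ZMod 2) (edgeVector g) ((fun x : M.E => (e x : Sym2 ι)) '' I) :=
      linearIndependent_equiv' (Equiv.Set.imageOfInjOn _ _
        (Subtype.val_injective.comp e.injective).injOn) rfl
    rw [← h1, ← h2]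
    exact Iff.of_eq (congrArg (LinearIndepOn (ZMod 2) · I) (funext he))
  constructor
  · intro h I
    rw [h _ (by rintro _ ⟨m, _, rfl⟩; exact m.2), key]
  · intro h I hI
    have hII : Subtype.val '' (Subtype.val ⁻¹' I : Set M.E) = I := by
      rwa [Subtype.image_preimage_coe, inter_eq_right]
    have := (h (Subtype.val ⁻¹' I)).trans (key _).symm
    rwa [hII] at this

lemma injOn_edgeVector_edgeSet {ι : Type*} {g : ι → V} (hg : AffinelyFree g)
    (G : SimpleGraph ι) : InjOn (edgeVector g) G.edgeSet :=
  hg.injOn_edgeVector.mono fun _ he => G.not_isDiag_of_mem_edgeSet he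

theorem Rep.isCycleMatroidOf (h : Rep M φ) (hi : InjOn φ M.E)
    (hE : IsFanoMinusPoint (φ '' M.E)) :
    M.IsCycleMatroidOf (⊤ : SimpleGraph (Fin 4)) := by
  obtain ⟨x, y, z, hxyz, himg⟩ := hE.eq_edgeVector_image
  have hg := affinelyFree_of_linearIndependent hxyz
  have hinj := injOn_edgeVector_edgeSet hg (⊤ : SimpleGraph (Fin 4))
  let e : M.E ≃ (⊤ : SimpleGraph (Fin 4)).edgeSet :=
    (Equiv.Set.imageOfInjOn φ M.E hi).trans
      ((Equiv.setCongr himg).trans (Equiv.Set.imageOfInjOn _ _ hinj).symm)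
  refine ⟨e, (rep_iff_isAcyclic hg e fun m => ?_).1 h⟩
  have h1 : Equiv.Set.imageOfInjOn _ _ hinj (e m) =
      Equiv.setCongr himg (Equiv.Set.imageOfInjOn φ M.E hi m) :=
    Equiv.apply_symm_apply _ _
  exact (congrArg Subtype.val h1).symm

theorem exists_rep_of_isCycleMatroidOf {x y z : V} (hi : LinearIndependent (ZMod 2) ![x, y, z])
    (hM : M.IsCycleMatroidOf (⊤ : SimpleGraph (Fin 4))) :
    ∃ φ : α → V, Rep M φ ∧ InjOn φ M.E ∧ IsFanoMinusPoint (φ '' M.E) := by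
  classical
  obtain ⟨e, he⟩ := hM
  have hg := affinelyFree_of_linearIndependent hi
  have hinj := injOn_edgeVector_edgeSet hg (⊤ : SimpleGraph (Fin 4))
  let φ : α → V := fun m => if h : m ∈ M.E then edgeVector ![0, x, y, z] (e ⟨m, h⟩) else 0
  have hφ : ∀ m : M.E, φ m = edgeVector ![0, x, y, z] (e m) := fun m => dif_pos m.2
  refine ⟨φ, (rep_iff_isAcyclic hg e hφ).2 he, fun m hm m' hm' hmm => ?_, ?_⟩
  · have h1 := hinj (e ⟨m, hm⟩).2 (e ⟨m', hm'⟩).2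
      ((hφ ⟨m, hm⟩).symm.trans (hmm.trans (hφ ⟨m', hm'⟩)))
    exact congrArg Subtype.val (e.injective (Subtype.ext h1))
  · convert isFanoMinusPoint_edgeVector_image hi using 1
    ext v
    constructor
    · rintro ⟨m, hm, rfl⟩
      exact ⟨_, (e ⟨m, hm⟩).2, (hφ ⟨m, hm⟩).symm⟩
    · rintro ⟨d, hd, rfl⟩
      refine ⟨_, (e.symm ⟨d, hd⟩).2, ?_⟩
      rw [hφ, Equiv.apply_symm_apply]

lemma linearIndepOn_id_triple {x y z : V} (h : LinearIndependent (ZMod 2) ![x, y, z]) :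
    LinearIndepOn (ZMod 2) id {x, y, z} := by
  have := h.linearIndepOn_id
  rwa [Matrix.range_cons, Matrix.range_cons, Matrix.range_cons, Matrix.range_empty, union_empty,
    singleton_union, singleton_union] at this

lemma IsFourCircuit.encard_eq {E : Set V} (h : IsFourCircuit E) : E.encard = 4 := by
  obtain ⟨a, b, p, hi, rfl⟩ := h
  obtain ⟨ha, hb, hp, hab, hap, hbp, habp⟩ := linearIndependent_triple_iff.1 hi
  have h1 : a ≠ b := fun h => hab (add_eq_zero_iff_eq'.2 h)
  have h2 : a ≠ b + p := fun h => habp (by rw [add_assoc]; exact add_eq_zero_iff_eq'.2 h)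
  have h3 : a + p ≠ b := fun h => habp (by
    rw [add_right_comm]; exact add_eq_zero_iff_eq'.2 h)
  rw [encard_insert_of_notMem, encard_insert_of_notMem, encard_insert_of_notMem,
    encard_singleton]
  · norm_num
  · simpa using hp
  · simpa [h3] using h1
  · simpa [h1, h2] using hp

lemma IsFourCircuit.linearIndepOn_iff {E : Set V} (h : IsFourCircuit E) {S : Set V}
    (hS : S ⊆ E) : LinearIndepOn (ZMod 2) id S ↔ S.encard ≤ 3 := by
  have hcard := h.encard_eq
  obtain ⟨a, b, p, hi, rfl⟩ := h
  obtain ⟨ha, hb, hp, hab, hap, hbp, habp⟩ := linearIndependent_triple_iff.1 hi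
  have h1 : a + p + b = a + b + p := add_right_comm _ _ _
  have h2 : a + (b + p) = a + b + p := (add_assoc _ _ _).symm
  have h3 : b + (b + p) = p := add_add_cancel_self _ _
  have h4 : a + (a + p) = p := add_add_cancel_self _ _
  have h5 : a + p + (b + p) = a + b := by
    rw [add_add_add_comm, add_self_eq_zero', add_zero]
  have h6 : a + p + b + (b + p) = a := by
    rw [add_assoc, h3, add_assoc, add_self_eq_zero', add_zero]
  have h7 : a + b + (b + p) = a + p := by
    rw [add_assoc, h3]
  have h8 : a + (a + p) + (b + p) = b := by
    rw [h4, add_comm b, add_add_cancel_self]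
  have h9 : a + (a + p) + b = b + p := by
    rw [h4, add_comm]
  constructor
  · intro hind
    by_contra hlt
    have hSE : S = {a, a + p, b, b + p} := by
      refine ((toFinite ({a, a + p, b, b + p} : Set V)).subset hS).eq_of_subset_of_encard_le hS ?_
      rw [hcard]
      exact Order.add_one_le_of_lt (not_le.1 hlt)
    rw [hSE] at hind
    have hn : a ∉ ({a + p, b, b + p} : Set V) := by
      rintro (h | h | h)
      · exact hp (left_eq_add.1 h)
      · exact hab (add_eq_zero_iff_eq'.2 h)
      · exact habp (h2 ▸ add_eq_zero_iff_eq'.2 h)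
    refine hind.notMem_span_of_insert hn ?_
    rw [image_id, id, mem_span_triple_iff]
    simp [h6]
  · intro hle
    have hex : ∃ x ∈ ({a, a + p, b, b + p} : Set V), x ∉ S := by
      by_contra! hall
      have := encard_le_encard hall
      rw [hcard] at this
      exact absurd (this.trans hle) (by decide)
    obtain ⟨x, hx, hxS⟩ := hex
    have hsub : ∀ y ∈ S, y ≠ x := fun y hy hyx => hxS (hyx ▸ hy)
    rcases hx with rfl | rfl | rfl | rfl
    · refine (linearIndepOn_id_triple (x := x + p) (y := b) (z := b + p)
        (linearIndependent_triple_iff.2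
          ⟨hap, hb, hbp, by rwa [h1], by rwa [h5], by rwa [h3], by rwa [h6]⟩)).mono fun y hy => ?_
      exact (hS hy).resolve_left (hsub y hy)
    · refine (linearIndepOn_id_triple (linearIndependent_triple_iff.2
        ⟨ha, hb, hbp, hab, by rwa [h2], by rwa [h3], by rwa [h7]⟩)).mono fun y hy => ?_
      exact (hS hy).imp id fun h => h.resolve_left (hsub y hy)
    · refine (linearIndepOn_id_triple (linearIndependent_triple_iff.2
        ⟨ha, hap, hbp, by rwa [h4], by rwa [h2], by rwa [h5], by rwa [h8]⟩)).mono fun y hy => ?_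
      exact (hS hy).imp id (Or.imp id fun h => h.resolve_left (hsub y hy))
    · refine (linearIndepOn_id_triple (linearIndependent_triple_iff.2
        ⟨ha, hap, hb, by rwa [h4], hab, by rwa [h1], by rwa [h9]⟩)).mono fun y hy => ?_
      exact (hS hy).imp id (Or.imp id fun h => h.resolve_right (hsub y hy))

lemma IsFourCircuit.rep_iff (hE : IsFourCircuit (φ '' M.E)) (hi : InjOn φ M.E) :
    Rep M φ ↔ ∀ I ⊆ M.E, (M.Indep I ↔ I.encard ≤ 3) := by
  refine forall₂_congr fun I hI => ?_
  rw [linearIndepOn_iff_image (hi.mono hI), hE.linearIndepOn_iff (image_mono hI),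
    (hi.mono hI).encard_image]

theorem Rep.isUniformMatroid (h : Rep M φ) (hi : InjOn φ M.E) (hE : IsFourCircuit (φ '' M.E)) :
    M.IsUniformMatroid 3 4 :=
  ⟨hi.encard_image ▸ hE.encard_eq, (hE.rep_iff hi).1 h⟩

theorem exists_rep_of_isUniformMatroid {E : Set V} (hE : IsFourCircuit E)
    (hM : M.IsUniformMatroid 3 4) :
    ∃ φ : α → V, Rep M φ ∧ InjOn φ M.E ∧ IsFourCircuit (φ '' M.E) := by
  obtain ⟨hcard, hind⟩ := hM
  obtain ⟨φ, hφ⟩ := (finite_of_encard_eq_coe hcard).exists_bijOn_of_encard_eq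
    (hcard.trans hE.encard_eq.symm)
  have hE' : IsFourCircuit (φ '' M.E) := hφ.image_eq.symm ▸ hE
  exact ⟨φ, (hE'.rep_iff hφ.injOn).2 hind, hφ.injOn, hE'⟩

lemma linearIndependent_standard :
    LinearIndependent (ZMod 2) (![![1, 0, 0], ![0, 1, 0], ![0, 0, 1]] :
      Fin 3 → Fin 3 → ZMod 2) :=
  linearIndependent_triple_iff.2 (by decide)

lemma IsFanoMinusPoint.zero_notMem {E : Set V} (h : IsFanoMinusPoint E) : (0 : V) ∉ E := by
  obtain ⟨a, b, p, hi, rfl⟩ := h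
  obtain ⟨ha, hb, hp, hab, hap, hbp, habp⟩ := linearIndependent_triple_iff.1 hi
  rintro (h | h | h | h | h | h)
  exacts [ha h.symm, hb h.symm, hab h.symm, hap h.symm, hbp h.symm, habp h.symm]

lemma IsFourCircuit.zero_notMem {E : Set V} (h : IsFourCircuit E) : (0 : V) ∉ E := by
  obtain ⟨a, b, p, hi, rfl⟩ := h
  obtain ⟨ha, hb, hp, hab, hap, hbp, habp⟩ := linearIndependent_triple_iff.1 hi
  rintro (h | h | h | h)
  exacts [ha h.symm, hap h.symm, hb h.symm, hbp h.symm]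

theorem isForbiddenInducedMinor_of_rep {φ : α → Fin 3 → ZMod 2} (h : Rep M φ) (hi : InjOn φ M.E)
    (h0 : (0 : Fin 3 → ZMod 2) ∉ φ '' M.E) (hv : ¬ VChordal (φ '' M.E)) :
    M.IsForbiddenInducedMinor (ZMod 2) := by
  refine h.isForbiddenInducedMinor
    (h.simple_iff.2 ⟨hi, fun e he he0 => h0 ⟨e, he, he0⟩⟩) ?_ hv
  exact (Submodule.finrank_le _).trans (finrank_fin_fun (ZMod 2)).le

end Recognition

end BinaryChordal

/-- The forbidden induced minors for the class of `GF(2)`-chordal matroids are, up to isomorphism,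
exactly `M(K₄)` and `U_{3,4}`. -/
theorem theorem3 {α : Type*} (M : Matroid α) :
    M.IsForbiddenInducedMinor (ZMod 2) ↔
      M.IsCycleMatroidOf (⊤ : SimpleGraph (Fin 4)) ∨ M.IsUniformMatroid 3 4 := by
  
  constructor
  · intro hM
    obtain ⟨n, φ, hφ⟩ := hM.representable
    have hr : BinaryChordal.Rep M φ := hφ
    have hi := (hr.simple_iff.1 hM.simple).1
    exact (BinaryChordal.Rep.isFourCircuit_or_isFanoMinusPoint hM hr).symm.imp
      (hr.isCycleMatroidOf hi) (hr.isUniformMatroid hi)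
  · rintro (hM | hM)
    · obtain ⟨φ, hr, hi, hE⟩ :=
        BinaryChordal.exists_rep_of_isCycleMatroidOf BinaryChordal.linearIndependent_standard hM
      exact BinaryChordal.isForbiddenInducedMinor_of_rep hr hi hE.zero_notMem hE.not_vchordal
    · obtain ⟨φ, hr, hi, hE⟩ := BinaryChordal.exists_rep_of_isUniformMatroid
        ⟨_, _, _, BinaryChordal.linearIndependent_standard, rfl⟩ hM
      exact BinaryChordal.isForbiddenInducedMinor_of_rep hr hi hE.zero_notMem hE.not_vchordal
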